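/- Let $\phi=\tanh$ and $\psi=\operatorname{sech}$ on $\mathbb R$, let $\langle\cdot,\cdot\rangle$ and $\|\cdot\|$ be the inner product and norm of $L^2(\mathbb R)$ (real-valued functions), and for $\beta>0$ and $\mu>-1$ consider the operators with domain $H^2(\mathbb R)$ $$C=-\partial_z^2-6\psi^2+4,\qquad D=D_\mu=-\partial_z^2-2\psi^2+\mu+1,\qquad L=\begin{pmatrix}0&D\\-C&-\beta\end{pmatrix},$$ where $L$ is the linearization of the (rescaled) parametric nonlinear Schrödinger system at the dark soliton $(\phi,0)$. Let $C^{-1}$ denote the inverse of $C$ on $\{\phi'\}^\perp$ with values in $\{\phi'\}^\perp$. For $\mu\neq0$ put $$\alpha_0=\frac{\|\phi'\|^2}{\beta\langle D^{-1}\phi',\phi'\rangle},\qquad \Psi_0^\dagger=\begin{pmatrix}\beta D^{-1}\phi'\\ \phi'\end{pmatrix},\qquad \overline q_1=\alpha_0D^{-1}\phi',$$ and for $\mu=0$ put $\alpha_0=0$, $\Psi_0^\dagger=(\psi,0)^t$, $\overline q_1=\frac{\|\phi'\|^2}{\beta\langle\phi',\psi\rangle}\psi$. In both cases let $$\overline p_1=C^{-1}(\phi'-\beta\overline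 q_1),\qquad \overline W_1=\begin{pmatrix}\alpha_0\overline p_1+\overline q_1\\-\overline p_1+\alpha_0\overline q_1\end{pmatrix},\qquad \nu=\nu(\mu)=\frac{\langle\overline W_1,\Psi_0^\dagger\rangle}{\langle(\phi',0)^t,\Psi_0^\dagger\rangle};$$ the last denominator is $\beta\langle D^{-1}\phi',\phi'\rangle$ if $\mu\ne0$ and $\langle\psi,\phi'\rangle$ if $\mu=0$. These are the coefficients $\alpha_0$ of $-\kappa_0$ and $\nu$ of $\varepsilon^2\Delta_s\kappa_0$ in the formal expansion $V=-\alpha_0\kappa_0+\varepsilon^2(\nu\Delta_s\kappa_0+\zeta\kappa_0^3)+O(\varepsilon^4)$ of the normal velocity of a curved dark-soliton interface with curvature $\kappa_0$. Then the following holds. 1. For all $\beta>0$ and $\mu>-1$ these objects are well defined. If $\mu\ne0$, then $Dr=\phi'$ has exactly one solution $r=D^{-1}\phi'\in H^2(\mathbb R)$, and $\langle D^{-1}\phi',\phi'\rangle\neq0$. The pair $(\overline p_1,\overline q_1)$ is the only $U\in H^2(\mathbb R)^2$ with first component orthogonal to $\phi'$ and $LU=(\alpha_0\phi',-\phi')^t$.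 Also $\langle(\phi',0)^t,\Psi_0^\dagger\rangle\ne0$. The coefficients are those selected by solvability: for real $\kappa,V_0$ the order-$\varepsilon$ equation $LU=-(V_0\phi',\kappa\phi')^t$ has a solution $U\in H^2(\mathbb R)^2$ if and only if $V_0=-\alpha_0\kappa$; and for real $k,V_2$ the part $LU=k\overline W_1-V_2(\phi',0)^t$ of the order-$\varepsilon^3$ equation that is proportional to $k=\Delta_s\kappa_0$ has a solution $U\in H^2(\mathbb R)^2$ if and only if $V_2=\nu k$. 2. For all $\beta>0$ and $\mu>-1$, $\alpha_0(\mu)$ has the sign of $\mu$ (positive for $\mu>0$, negative for $\mu<0$, zero for $\mu=0$). 3. For every fixed $\beta>0$, as $\mu\to0$, $$\nu(\mu)=\frac{\|\phi'\|^2\|\psi\|^2}{\beta\,\langle\psi,\phi'\rangle^2}+O(\mu).$$ 4. There is $\mu_*\in(0,1)$, independent of $\varepsilon$ (and of $\beta$), such that $\nu(\mu)>0$ whenever $\beta>0$ and $|\mu|<\mu_*$. For such $\beta,\mu$, surface diffusion regularizes the linear part $\partial_T\kappa=\alpha_0\Delta\kappa-\varepsilon^2\nu\Delta^2\kappa$ of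 the curvature evolution $\partial_T\kappa=-(\Delta+\kappa^2)V$: for every $\varepsilon>0$ the growth rate $k\mapsto-\alpha_0k^2-\varepsilon^2\nu k^4$ of the Fourier modes is bounded above on $\mathbb R$ and tends to $-\infty$ as $k\to\infty$, whereas for $\mu<0$ the growth rate $-\alpha_0k^2$ without surface diffusion tends to $+\infty$. -/

import Mathlib

open MeasureTheory Filter Topology
open scoped ContDiff BoundedContinuousFunction

/-! ### The space `L²(ℝ)`, weak derivatives and Schrödinger operators on `H²(ℝ)` -/

/-- The real Hilbert space `L²(ℝ)`, with inner product `⟨u, v⟩ = ∫ u v`. -/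
abbrev L2R : Type := Lp ℝ 2 (volume : Measure ℝ)

/-- `v` is the weak derivative of `u`, both in `L²(ℝ)`. -/
def HasWeakDeriv (u v : L2R) : Prop :=
  ∀ η : ℝ → ℝ, ContDiff ℝ ∞ η → HasCompactSupport η →
    ∫ x, u x * deriv η x = -∫ x, v x * η x

theorem integrable_mul_test (u : L2R) {η : ℝ → ℝ} (h1 : Continuous η)
    (h2 : HasCompactSupport η) : Integrable (fun x => u x * η x) := by
  have hu : LocallyIntegrable u volume :=
    (Lp.memLp u).locallyIntegrable (by norm_num)
  have := hu.integrable_smul_left_of_hasCompactSupport h1 h2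
  simpa [smul_eq_mul, mul_comm] using this

theorem HasWeakDeriv.unique {u v w : L2R} (hv : HasWeakDeriv u v) (hw : HasWeakDeriv u w) :
    v = w := by
  refine Lp.ext (ae_eq_of_integral_contDiff_smul_eq
    ((Lp.memLp v).locallyIntegrable (by norm_num))
    ((Lp.memLp w).locallyIntegrable (by norm_num)) ?_)
  intro g hg hgs
  have h1 := hv g hg hgs
  have h2 := hw g hg hgs
  rw [h1] at h2
  simpa [smul_eq_mul, mul_comm] using neg_injective h2

theorem HasWeakDeriv.add {u v u' v' : L2R} (h : HasWeakDeriv u v) (h' : HasWeakDeriv u' v') :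
    HasWeakDeriv (u + u') (v + v') := by
  intro η hη hs
  have hd : Continuous (deriv η) := hη.continuous_deriv (by simp)
  have e1 : ∫ x, (u + u' : L2R) x * deriv η x
      = ∫ x, (u x * deriv η x + u' x * deriv η x) := by
    refine integral_congr_ae ?_
    filter_upwards [Lp.coeFn_add u u'] with x hx
    rw [hx, Pi.add_apply, add_mul]
  have e2 : ∫ x, (v + v' : L2R) x * η x = ∫ x, (v x * η x + v' x * η x) := by
    refine integral_congr_ae ?_
    filter_upwards [Lp.coeFn_add v v'] with x hx
    rw [hx, Pi.add_apply, add_mul]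
  rw [e1, e2, integral_add (integrable_mul_test u hd hs.deriv) (integrable_mul_test u' hd hs.deriv),
    integral_add (integrable_mul_test v hη.continuous hs)
      (integrable_mul_test v' hη.continuous hs), h η hη hs, h' η hη hs]
  ring

theorem HasWeakDeriv.smul {u v : L2R} (c : ℝ) (h : HasWeakDeriv u v) :
    HasWeakDeriv (c • u) (c • v) := by
  intro η hη hs
  have e1 : ∫ x, (c • u : L2R) x * deriv η x = ∫ x, c * (u x * deriv η x) := by
    refine integral_congr_ae ?_
    filter_upwards [Lp.coeFn_smul c u] with x hx
    rw [hx, Pi.smul_apply, smul_eq_mul, mul_assoc]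
  have e2 : ∫ x, (c • v : L2R) x * η x = ∫ x, c * (v x * η x) := by
    refine integral_congr_ae ?_
    filter_upwards [Lp.coeFn_smul c v] with x hx
    rw [hx, Pi.smul_apply, smul_eq_mul, mul_assoc]
  rw [e1, e2, integral_const_mul, integral_const_mul, h η hη hs]
  ring

theorem HasWeakDeriv.zero : HasWeakDeriv 0 0 := by
  have h : ∀ g : ℝ → ℝ, ∫ x, (0 : L2R) x * g x = 0 := by
    intro g
    rw [← integral_zero ℝ ℝ (μ := volume)]
    refine integral_congr_ae ?_
    filter_upwards [Lp.coeFn_zero ℝ 2 (volume : Measure ℝ)] with x hx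
    rw [hx, Pi.zero_apply, zero_mul]
  intro η _ _
  rw [h, h, neg_zero]

/-- The graph of `∂²` in `L²(ℝ)`: the pairs `(u, u'')` with `u ∈ H²(ℝ)`, i.e. with `u`, `u'`, `u''`
in `L²(ℝ)` in the weak sense. -/
def secondDerivGraph : Submodule ℝ (L2R × L2R) where
  carrier := {p | ∃ v : L2R, HasWeakDeriv p.1 v ∧ HasWeakDeriv v p.2}
  add_mem' := by
    rintro a b ⟨v, h1, h2⟩ ⟨w, h3, h4⟩
    exact ⟨v + w, h1.add h3, h2.add h4⟩
  zero_mem' := ⟨0, HasWeakDeriv.zero, HasWeakDeriv.zero⟩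
  smul_mem' := by
    rintro c a ⟨v, h1, h2⟩
    exact ⟨c • v, h1.smul c, h2.smul c⟩

theorem secondDerivGraph_snd_eq_zero (p : L2R × L2R) (hp : p ∈ secondDerivGraph)
    (h : p.1 = 0) : p.2 = 0 := by
  obtain ⟨v, h1, h2⟩ := hp
  rw [h] at h1
  have hv : v = 0 := h1.unique HasWeakDeriv.zero
  rw [hv] at h2
  exact h2.unique HasWeakDeriv.zero

/-- The unbounded operator `∂²` on `L²(ℝ)`, with domain `H²(ℝ)`. -/
noncomputable def secondDeriv : L2R →ₗ.[ℝ] L2R := secondDerivGraph.toLinearPMap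

theorem secondDeriv_graph : secondDeriv.graph = secondDerivGraph :=
  Submodule.toLinearPMap_graph_eq _ secondDerivGraph_snd_eq_zero

theorem memLp_bounded_mul (V : ℝ →ᵇ ℝ) (u : L2R) : MemLp (fun x => V x * u x) 2 volume := by
  have h : MemLp (fun x => V x) ⊤ (volume : Measure ℝ) := V.memLp_top
  exact (Lp.memLp u).mul h

/-- Multiplication by a bounded continuous function. -/
noncomputable def mulOp (V : ℝ →ᵇ ℝ) : L2R →ₗ[ℝ] L2R where
  toFun u := (memLp_bounded_mul V u).toLp _
  map_add' u v := by
    rw [← MemLp.toLp_add]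
    refine MemLp.toLp_congr _ _ ?_
    filter_upwards [Lp.coeFn_add u v] with x hx
    simp only [hx, Pi.add_apply, mul_add]
  map_smul' c u := by
    rw [RingHom.id_apply, ← MemLp.toLp_const_smul]
    refine MemLp.toLp_congr _ _ ?_
    filter_upwards [Lp.coeFn_smul c u] with x hx
    simp only [hx, Pi.smul_apply, smul_eq_mul]
    ring

/-- The Schrödinger operator `-∂² + V` on `L²(ℝ)`, with domain `H²(ℝ)`. -/
noncomputable def schrodinger (V : ℝ →ᵇ ℝ) : L2R →ₗ.[ℝ] L2R := mulOp V +ᵥ (-secondDeriv)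

open Classical in
/-- The solution `u ∈ S` of `A u = f`, i.e. the value at `f` of the inverse of `A` restricted to `S`
(`0` if there is no solution). -/
noncomputable def solveIn (A : L2R →ₗ.[ℝ] L2R) (S : Submodule ℝ L2R) (f : L2R) : L2R :=
  if h : ∃ u : A.domain, (u : L2R) ∈ S ∧ A u = f then (h.choose : L2R) else 0

/-! ### The dark soliton and the linearized operators -/

/-- `ψ = sech`. -/
noncomputable def sech (x : ℝ) : ℝ := (Real.cosh x)⁻¹

theorem sech_continuous : Continuous sech :=
  Real.continuous_cosh.inv₀ (fun x => (Real.cosh_pos x).ne')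

theorem sech_pos (x : ℝ) : 0 < sech x := inv_pos.mpr (Real.cosh_pos x)

theorem sech_le_one (x : ℝ) : sech x ≤ 1 := inv_le_one_of_one_le₀ (Real.one_le_cosh x)

theorem sech_sq_le (x : ℝ) : sech x ^ 2 ≤ (1 + x ^ 2)⁻¹ := by
  have h : x ^ 2 ≤ Real.sinh x ^ 2 := by
    rcases le_total 0 x with hx | hx
    · have := Real.self_le_sinh_iff.mpr hx
      nlinarith
    · have := Real.sinh_le_self_iff.mpr hx
      nlinarith
  rw [sech, inv_pow, Real.cosh_sq']
  exact inv_anti₀ (by positivity) (by linarith)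

theorem deriv_tanh_eq (x : ℝ) : deriv Real.tanh x = sech x ^ 2 := by
  have e : Real.tanh = fun y => Real.sinh y / Real.cosh y := by
    funext y
    exact Real.tanh_eq_sinh_div_cosh y
  have hc := (Real.cosh_pos x).ne'
  have h := (Real.hasDerivAt_sinh x).div (Real.hasDerivAt_cosh x) hc
  have h' : HasDerivAt (fun y => Real.sinh y / Real.cosh y)
      ((Real.cosh x * Real.cosh x - Real.sinh x * Real.sinh x) / Real.cosh x ^ 2) x := h
  rw [e, h'.deriv, sech]
  have := Real.cosh_sq x
  field_simp
  linarith

theorem memLp_sech : MemLp sech 2 (volume : Measure ℝ) := by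
  rw [memLp_two_iff_integrable_sq sech_continuous.aestronglyMeasurable]
  refine integrable_inv_one_add_sq.mono' (sech_continuous.pow 2).aestronglyMeasurable
    (Eventually.of_forall fun x => ?_)
  rw [Real.norm_of_nonneg (by positivity)]
  exact sech_sq_le x

theorem memLp_deriv_tanh : MemLp (deriv Real.tanh) 2 (volume : Measure ℝ) := by
  have e : deriv Real.tanh = fun x => sech x ^ 2 := funext deriv_tanh_eq
  rw [e]
  refine memLp_sech.mono (sech_continuous.pow 2).aestronglyMeasurable
    (Eventually.of_forall fun x => ?_)
  have h0 := sech_pos x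
  have h1 := sech_le_one x
  rw [Real.norm_of_nonneg (by positivity), Real.norm_of_nonneg h0.le]
  nlinarith

/-- `ψ = sech` as an element of `L²(ℝ)`. -/
noncomputable def psi : L2R := memLp_sech.toLp sech

/-- `φ'` as an element of `L²(ℝ)`, where `φ = tanh` is the dark soliton. -/
noncomputable def dphi : L2R := memLp_deriv_tanh.toLp (deriv Real.tanh)

/-- The potential `b - a ψ²`. -/
noncomputable def potential (a b : ℝ) : ℝ →ᵇ ℝ :=
  BoundedContinuousFunction.ofNormedAddCommGroup (fun x => b - a * sech x ^ 2)
    (continuous_const.sub (continuous_const.mul (sech_continuous.pow 2))) (|b| + |a|) (by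
      intro x
      have h0 := sech_pos x
      have h1 := sech_le_one x
      have h2 : |sech x ^ 2| ≤ 1 := by
        rw [abs_of_nonneg (by positivity)]
        nlinarith
      calc ‖b - a * sech x ^ 2‖ ≤ |b| + |a * sech x ^ 2| := abs_sub _ _
        _ ≤ |b| + |a| := by
          rw [abs_mul]
          nlinarith [abs_nonneg a])

/-- `C = -∂² - 6ψ² + 4`, with domain `H²(ℝ)`. -/
noncomputable def opC : L2R →ₗ.[ℝ] L2R := schrodinger (potential 6 4)

/-- `D = -∂² - 2ψ² + μ + 1`, with domain `H²(ℝ)`. -/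
noncomputable def opD (μ : ℝ) : L2R →ₗ.[ℝ] L2R := schrodinger (potential 2 (μ + 1))

/-- The linearization `L = ((0, D), (-C, -β))` of the system at the dark soliton `(φ, 0)`, acting
on `H²(ℝ) × H²(ℝ)`. -/
noncomputable def opL (β μ : ℝ) (U : opC.domain × (opD μ).domain) : L2R × L2R :=
  (opD μ U.2, -opC U.1 - β • (U.2 : L2R))

/-- `C⁻¹` on the orthogonal complement of `ker C = span φ'`, with values in that complement. -/
noncomputable def invC (f : L2R) : L2R := solveIn opC (ℝ ∙ dphi)ᗮ f

/-- `D⁻¹`. -/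
noncomputable def invD (μ : ℝ) (f : L2R) : L2R := solveIn (opD μ) ⊤ f

/-- The `L²` inner product of vector-valued functions. -/
noncomputable def pairing (F G : L2R × L2R) : ℝ := inner ℝ F.1 G.1 + inner ℝ F.2 G.2

/-! ### The coefficients of the normal velocity -/

/-- The curvature coefficient `α₀ = ‖φ'‖² / (β ⟨D⁻¹ φ', φ'⟩)`, extended by its limit `0` to `μ = 0`,
where `D` has the kernel `span ψ`. -/
noncomputable def alpha0 (β μ : ℝ) : ℝ :=
  if μ = 0 then 0 else ‖dphi‖ ^ 2 / (β * inner ℝ (invD μ dphi) dphi)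

/-- The spanning vector `Ψ₀†` of the kernel of the adjoint of `L`. -/
noncomputable def adjointKernel (β μ : ℝ) : L2R × L2R :=
  if μ = 0 then (psi, 0) else (β • invD μ dphi, dphi)

/-- The component `q̄₁` of the first correction: `α₀ D⁻¹ φ'`, and
`(‖φ'‖² / (β ⟨φ', ψ⟩)) ψ` at `μ = 0`. -/
noncomputable def qBar1 (β μ : ℝ) : L2R :=
  if μ = 0 then (‖dphi‖ ^ 2 / (β * inner ℝ dphi psi)) • psi else alpha0 β μ • invD μ dphi

/-- The component `p̄₁ = C⁻¹ (φ' - β q̄₁)` of the first correction; for `μ ≠ 0` it is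
`C⁻¹ (1 - β α₀ D⁻¹) φ'`. -/
noncomputable def pBar1 (β μ : ℝ) : L2R := invC (dphi - β • qBar1 β μ)

/-- The vector `W̄₁` that multiplies `Δ_s κ₀` at the order `ε³` of the inner expansion. -/
noncomputable def wBar1 (β μ : ℝ) : L2R × L2R :=
  (alpha0 β μ • pBar1 β μ + qBar1 β μ, -pBar1 β μ + alpha0 β μ • qBar1 β μ)

/-- The surface diffusion coefficient `ν = ⟨W̄₁, Ψ₀†⟩ / ⟨(φ', 0), Ψ₀†⟩`; the denominator is
`β ⟨D⁻¹ φ', φ'⟩` for `μ ≠ 0` and `⟨ψ, φ'⟩` for `μ = 0`. -/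
noncomputable def nu (β μ : ℝ) : ℝ :=
  pairing (wBar1 β μ) (adjointKernel β μ) / pairing (dphi, 0) (adjointKernel β μ)

/-- The growth rate of the Fourier mode of wave number `k` for the linear part
`∂_T κ = α₀ Δ κ - ε² ν Δ² κ` of `∂_T κ = -(Δ + κ²) V`, `V = -α₀ κ + ε² (ν Δ κ + ζ κ³)`. -/
noncomputable def growthRate (β μ ε k : ℝ) : ℝ :=
  -alpha0 β μ * k ^ 2 - ε ^ 2 * nu β μ * k ^ 4

/-!
Write `φ = tanh`, `ψ = sech`. Everything rests on the factorization of Pöschl–Teller operators,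
`(-∂ + n φ) (∂ + n φ) = -∂² - (n² + n) ψ² + n²`: the operator `C` is the case `n = 2`, and `D` is
the case `n = 1` shifted by `μ`. Exchanging the factors gives `-∂² - (n² - n) ψ² + n²`, so the
partner of `D` is the free operator `-∂² + 1 + μ`, and the partner of `C` is `-∂² - 2ψ² + 4`, which
is `D` with `μ = 3`. Both are bounded below by a positive constant, hence invertible by the
projection theorem (`PoschlTeller.exists_of_pos`), and intertwining carries the inverse back to `D`
if `μ ≠ 0`, and to `C` and, at `μ = 0`, to `D` on the orthogonal complements of their kernels
(`PoschlTeller.of_partner`, `PoschlTeller.exists_of_orthogonal`). The kernels of `∂ + n φ` are the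
multiples of `ψⁿ` by the lemma of du Bois-Reymond. This gives the Fredholm alternative for `L`
(`exists_opL_eq_iff_pairing`), from which the two solvability conditions are read off.

The sign of `α₀` is that of `⟨D⁻¹ φ', φ'⟩`. By the intertwining relation,
`μ ⟨D⁻¹ φ', φ'⟩ = ‖φ'‖² - ⟨(-∂² + 1 + μ)⁻¹ g, g⟩` with `g = (∂ + φ) φ' = (φ' / 2)'`, and for every
`μ > -1` the subtracted term lies between `0` and `‖φ'‖² / 4` because `g` is a derivative
(`exists_poschlTeller_one_dphi`). The same estimate gives `β |α₀| ≤ 4 |μ| / 3`.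

For `ν`, put `s = β q̄₁`, so that `D s = β α₀ φ'`, `C p̄₁ = φ' - s` and `⟨s, φ'⟩ = ‖φ'‖²`. Then
`ν = (‖s‖² - β α₀ ⟨C p̄₁, p̄₁⟩ + α₀² ‖φ'‖²) / (β ‖φ'‖²)` for all `μ > -1`, including `μ = 0`
(`nu_eq`). The lower bound `3` of the partner of `C` yields `0 ≤ ⟨C p̄₁, p̄₁⟩ ≤ ‖s‖² / 3`, which makes
`ν` positive for all `|μ| < 1`. As `μ → 0`, the part of `s` orthogonal to `ψ` is `O(μ)` by the lower
bound of `D` there, and the normalization `⟨s, φ'⟩ = ‖φ'‖²` fixes the part along `ψ`.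
-/

/-! ### Weak derivatives in `L²(ℝ)` -/

/-- A smooth compactly supported function of mean zero has a compactly supported primitive. -/
theorem exists_test_primitive {f : ℝ → ℝ} (hf : ContDiff ℝ ∞ f) (hs : HasCompactSupport f)
    (h0 : ∫ x, f x = 0) : ∃ η : ℝ → ℝ, ContDiff ℝ ∞ η ∧ HasCompactSupport η ∧ deriv η = f := by
  obtain ⟨R, hR⟩ := hs.isCompact.isBounded.subset_closedBall (0 : ℝ)
  rw [Real.closedBall_eq_Icc, zero_sub, zero_add] at hR
  have hz : ∀ x, x ∉ Set.Icc (-R) R → f x = 0 := fun x hx =>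
    image_eq_zero_of_notMem_tsupport fun h => hx (hR h)
  have hd : ∀ x, HasDerivAt (fun y => ∫ t in (-R - 1)..y, f t) (f x) x := fun x =>
    intervalIntegral.integral_hasDerivAt_right (hf.continuous.intervalIntegrable _ _)
      hf.continuous.stronglyMeasurable.stronglyMeasurableAtFilter hf.continuous.continuousAt
  have hde : deriv (fun y => ∫ t in (-R - 1)..y, f t) = f := funext fun x => (hd x).deriv
  refine ⟨fun y => ∫ t in (-R - 1)..y, f t, ?_, ?_, hde⟩
  · rw [contDiff_infty_iff_deriv, hde]
    exact ⟨fun x => (hd x).differentiableAt, hf⟩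
  · refine HasCompactSupport.intro (isCompact_Icc (a := -R) (b := R)) fun x hx => ?_
    rcases lt_or_ge x (-R) with h | h
    · refine (intervalIntegral.integral_congr (g := fun _ => 0) fun t ht => hz t fun h' => ?_).trans
        (by simp)
      rcases Set.mem_uIcc.mp ht with h1 | h1 <;> linarith [h1.1, h1.2, h'.1, h'.2]
    · have hx' : R < x := not_le.mp fun h' => hx ⟨h, h'⟩
      rw [intervalIntegral.integral_eq_integral_of_support_subset, h0]
      intro t ht
      by_contra h'
      refine ht (hz t fun h2 => h' ⟨by linarith [h2.1], by linarith [h2.2]⟩)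

/-- The lemma of du Bois-Reymond: a locally integrable function with vanishing weak derivative is
constant. -/
theorem ae_eq_const_of_integral_mul_deriv_eq_zero {w : ℝ → ℝ} (hw : LocallyIntegrable w volume)
    (h : ∀ η : ℝ → ℝ, ContDiff ℝ ∞ η → HasCompactSupport η → ∫ x, w x * deriv η x = 0) :
    ∃ c : ℝ, ∀ᵐ x, w x = c := by
  -- a test function `g` minus `(∫ g) g₀`, with `∫ g₀ = 1`, is the derivative of a test function
  let b : ContDiffBump (0 : ℝ) := ⟨1, 2, one_pos, one_lt_two⟩
  set g₀ : ℝ → ℝ := b.normed volume with hg₀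
  have hc₀ : ContDiff ℝ ∞ g₀ := b.contDiff_normed
  have hs₀ : HasCompactSupport g₀ := b.hasCompactSupport_normed
  have hi₀ : ∫ x, g₀ x = 1 := b.integral_normed
  have key : ∀ {g : ℝ → ℝ}, Continuous g → HasCompactSupport g →
      Integrable (fun x => w x * g x) := fun h1 h2 => by
    simpa [smul_eq_mul, mul_comm] using hw.integrable_smul_left_of_hasCompactSupport h1 h2
  refine ⟨∫ x, w x * g₀ x, ?_⟩
  refine ae_eq_of_integral_contDiff_smul_eq hw (locallyIntegrable_const _) fun g hg hgs => ?_
  have hgi : Integrable g := hg.continuous.integrable_of_hasCompactSupport hgs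
  have hgi₀ : Integrable g₀ := hc₀.continuous.integrable_of_hasCompactSupport hs₀
  obtain ⟨η, hη, hηs, hd⟩ := exists_test_primitive (f := fun x => g x - (∫ y, g y) * g₀ x)
    (hg.sub (contDiff_const.mul hc₀)) (hgs.sub hs₀.mul_left)
    (by rw [integral_sub hgi (hgi₀.const_mul _), integral_const_mul, hi₀, mul_one, sub_self])
  have h1 := h η hη hηs
  rw [hd] at h1
  have e : ∀ x, w x * (g x - (∫ y, g y) * g₀ x) = w x * g x - (∫ y, g y) * (w x * g₀ x) :=
    fun x => by ring
  simp only [e] at h1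
  rw [integral_sub (key hg.continuous hgs) ((key hc₀.continuous hs₀).const_mul _),
    integral_const_mul, sub_eq_zero] at h1
  simp only [smul_eq_mul]
  rw [integral_mul_const, ← h1]
  exact integral_congr_ae (Eventually.of_forall fun x => mul_comm _ _)

theorem locallyIntegrable_L2R (u : L2R) : LocallyIntegrable u volume :=
  (Lp.memLp u).locallyIntegrable (by norm_num)

/-- The solutions of the first order equation `a u' = -a' u` are the multiples of `1 / a`. -/
theorem HasWeakDeriv.ae_mul_eq_const {u v : L2R} (h : HasWeakDeriv u v) {a : ℝ → ℝ}
    (ha : ContDiff ℝ ∞ a) (hv : ∀ᵐ x, a x * v x = -(deriv a x * u x)) :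
    ∃ c : ℝ, ∀ᵐ x, a x * u x = c := by
  refine ae_eq_const_of_integral_mul_deriv_eq_zero ?_ fun η hη hs => ?_
  · exact (locallyIntegrable_L2R u).continuous_mul ha.continuous
  have hda : Continuous (deriv a) := ha.continuous_deriv (by simp)
  have hdη : Continuous (deriv η) := hη.continuous_deriv (by simp)
  have hd : ∀ x, deriv (fun y => a y * η y) x = deriv a x * η x + a x * deriv η x := fun x =>
    deriv_fun_mul (ha.differentiable (by simp) x) (hη.differentiable (by simp) x)
  have h1 := h (fun x => a x * η x) (ha.mul hη) hs.mul_left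
  have h2 : ∫ x, v x * (a x * η x) = -∫ x, u x * (deriv a x * η x) := by
    rw [← integral_neg]
    refine integral_congr_ae ?_
    filter_upwards [hv] with x hx
    linear_combination η x * hx
  rw [h2, neg_neg] at h1
  simp only [hd, mul_add] at h1
  rw [integral_add
    (integrable_mul_test u (η := fun x => deriv a x * η x) (hda.mul hη.continuous) hs.mul_left)
    (integrable_mul_test u (η := fun x => a x * deriv η x) (ha.continuous.mul hdη)
      hs.deriv.mul_left)] at h1
  have h3 : ∫ x, u x * (a x * deriv η x) = 0 := by linarith
  rw [← h3]
  exact integral_congr_ae (Eventually.of_forall fun x => by ring)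

/-- Classical derivatives of square integrable functions are weak derivatives. -/
theorem hasWeakDeriv_toLp {f f' : ℝ → ℝ} (hf : MemLp f 2 (volume : Measure ℝ))
    (hf' : MemLp f' 2 (volume : Measure ℝ)) (h : ∀ x, HasDerivAt f (f' x) x) :
    HasWeakDeriv (hf.toLp f) (hf'.toLp f') := by
  intro η hη hs
  have hc : Continuous (deriv η) := hη.continuous_deriv (by simp)
  have hη2 : MemLp η 2 (volume : Measure ℝ) := hη.continuous.memLp_of_hasCompactSupport hs
  have hη2' : MemLp (deriv η) 2 (volume : Measure ℝ) := hc.memLp_of_hasCompactSupport hs.deriv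
  have e1 : ∫ x, hf.toLp f x * deriv η x = ∫ x, f x * deriv η x := by
    refine integral_congr_ae ?_
    filter_upwards [hf.coeFn_toLp] with x hx
    rw [hx]
  have e2 : ∫ x, hf'.toLp f' x * η x = ∫ x, f' x * η x := by
    refine integral_congr_ae ?_
    filter_upwards [hf'.coeFn_toLp] with x hx
    rw [hx]
  rw [e1, e2]
  exact integral_mul_deriv_eq_deriv_mul_of_integrable (fun x _ => h x)
    (fun x _ => (hη.differentiable (by simp) x).hasDerivAt) (hf.integrable_mul hη2')
    (hf'.integrable_mul hη2) (hf.integrable_mul hη2)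

theorem not_ae_exp_mul_eq_const {u : L2R} {k c : ℝ} (hk : k ≠ 0) (hc : c ≠ 0)
    (h : ∀ᵐ x, Real.exp (k * x) * u x = c) : False := by
  have hi : Integrable (fun x => u x ^ 2) := (Lp.memLp u).integrable_sq
  have hcst : ∀ s : Set ℝ, MeasurableSet s → volume s = ⊤ → (∀ x ∈ s, k * x ≤ 0) → False := by
    intro s hs hv hx
    have h1 : IntegrableOn (fun _ : ℝ => c ^ 2) s := by
      refine Integrable.mono' (hi.integrableOn (s := s)) aestronglyMeasurable_const ?_
      filter_upwards [ae_restrict_mem hs, ae_restrict_of_ae h] with x hxs hxe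
      have h2 : Real.exp (k * x) ≤ 1 := Real.exp_le_one_iff.mpr (hx x hxs)
      have h3 := Real.exp_pos (k * x)
      rw [Real.norm_of_nonneg (sq_nonneg c), ← hxe, mul_pow]
      have h4 : Real.exp (k * x) ^ 2 ≤ 1 := by nlinarith
      nlinarith [sq_nonneg (u x)]
    rw [integrableOn_const_iff] at h1
    rcases h1 with h1 | h1
    · exact hc (by simpa using h1)
    · rw [hv] at h1
      exact lt_irrefl _ h1
  rcases lt_or_gt_of_ne hk with hk | hk
  · exact hcst (Set.Ici 0) measurableSet_Ici Real.volume_Ici fun x hx =>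
      mul_nonpos_of_nonpos_of_nonneg hk.le hx
  · exact hcst (Set.Iic 0) measurableSet_Iic Real.volume_Iic fun x hx =>
      mul_nonpos_of_nonneg_of_nonpos hk.le hx

/-- The equation `u' = -k u` with `k ≠ 0` has only the trivial solution in `L²(ℝ)`. -/
theorem HasWeakDeriv.eq_zero_of_eq_smul {u : L2R} {k : ℝ} (hk : k ≠ 0)
    (h : HasWeakDeriv u (-k • u)) : u = 0 := by
  have hd : ∀ x, HasDerivAt (fun y => Real.exp (k * y)) (Real.exp (k * x) * k) x := fun x => by
    simpa using ((hasDerivAt_id x).const_mul k).exp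
  obtain ⟨c, hc⟩ := h.ae_mul_eq_const (a := fun x => Real.exp (k * x)) (by fun_prop) (by
    filter_upwards [Lp.coeFn_smul (-k) u] with x hx
    rw [hx, (hd x).deriv, Pi.smul_apply, smul_eq_mul]
    ring)
  by_cases h0 : c = 0
  · refine Lp.ext ?_
    filter_upwards [hc, Lp.coeFn_zero ℝ 2 (volume : Measure ℝ)] with x hx hx0
    rw [hx0, Pi.zero_apply]
    rw [h0] at hx
    exact (mul_eq_zero.mp hx).resolve_left (Real.exp_pos _).ne'
  · exact (not_ae_exp_mul_eq_const hk h0 hc).elim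

theorem HasWeakDeriv.neg {u v : L2R} (h : HasWeakDeriv u v) : HasWeakDeriv (-u) (-v) := by
  simpa using h.smul (-1)

theorem HasWeakDeriv.sub {u v u' v' : L2R} (h : HasWeakDeriv u v) (h' : HasWeakDeriv u' v') :
    HasWeakDeriv (u - u') (v - v') := by
  simpa [sub_eq_add_neg] using h.add h'.neg

/-- `u'' = u` has only the trivial solution in `L²(ℝ)`. -/
theorem HasWeakDeriv.eq_zero_of_deriv_deriv_eq {u v : L2R} (h : HasWeakDeriv u v)
    (h' : HasWeakDeriv v u) : u = 0 := by
  -- `u + u'` and `u - u'` solve `w' = w` and `w' = -w`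
  have h1 : u + v = 0 := by
    refine HasWeakDeriv.eq_zero_of_eq_smul (k := -1) (by norm_num) ?_
    simpa [add_comm] using h.add h'
  have h2 : u - v = 0 := by
    refine HasWeakDeriv.eq_zero_of_eq_smul (k := 1) (by norm_num) ?_
    simpa using h.sub h'
  have h3 : (2 : ℝ) • u = 0 := by
    rw [two_smul]
    calc u + u = (u + v) + (u - v) := by abel
      _ = 0 := by rw [h1, h2, add_zero]
  exact (smul_eq_zero.mp h3).resolve_left (by norm_num)

/-! ### Integration by parts -/

theorem inner_L2R_eq_integral (u v : L2R) : inner ℝ u v = ∫ x, u x * v x := by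
  rw [L2.inner_def]
  refine integral_congr_ae (Eventually.of_forall fun x => ?_)
  simp [mul_comm]

theorem inner_toLp_right (u : L2R) {f : ℝ → ℝ} (hf : MemLp f 2 (volume : Measure ℝ)) :
    inner ℝ u (hf.toLp f) = ∫ x, u x * f x := by
  rw [inner_L2R_eq_integral]
  refine integral_congr_ae ?_
  filter_upwards [hf.coeFn_toLp] with x hx
  rw [hx]

theorem memLp_of_test {η : ℝ → ℝ} (h : Continuous η) (hs : HasCompactSupport η) :
    MemLp η 2 (volume : Measure ℝ) := h.memLp_of_hasCompactSupport hs

/-- The pairs `(η, η')` of a test function and its derivative, as elements of `L² × L²`. -/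
def testPairs : Set (L2R × L2R) :=
  {p | ∃ (η : ℝ → ℝ) (hη : ContDiff ℝ ∞ η) (hs : HasCompactSupport η),
    p = ((memLp_of_test hη.continuous hs).toLp η,
      (memLp_of_test (hη.continuous_deriv (by simp)) hs.deriv).toLp (deriv η))}

theorem hasWeakDeriv_iff_inner {u v : L2R} :
    HasWeakDeriv u v ↔ ∀ p ∈ testPairs, inner ℝ u p.2 = -inner ℝ v p.1 := by
  constructor
  · rintro h _ ⟨η, hη, hs, rfl⟩
    rw [inner_toLp_right, inner_toLp_right]
    exact h η hη hs
  · intro h η hη hs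
    have := h _ ⟨η, hη, hs, rfl⟩
    rwa [inner_toLp_right, inner_toLp_right] at this

theorem hasWeakDeriv_of_mem_testPairs {p : L2R × L2R} (hp : p ∈ testPairs) :
    HasWeakDeriv p.1 p.2 := by
  obtain ⟨η, hη, hs, rfl⟩ := hp
  exact hasWeakDeriv_toLp (memLp_of_test hη.continuous hs)
    (memLp_of_test (hη.continuous_deriv (by simp)) hs.deriv)
    fun x => (hη.differentiable (by simp) x).hasDerivAt

theorem isClosed_hasWeakDeriv : IsClosed {p : L2R × L2R | HasWeakDeriv p.1 p.2} := by
  simp only [hasWeakDeriv_iff_inner, Set.ofPred_forall]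
  exact isClosed_iInter fun p => isClosed_iInter fun _ => isClosed_eq (by fun_prop) (by fun_prop)

/-- The closure of the test pairs in the Hilbert space `L² ⊕ L²`. -/
noncomputable def testClosure : Submodule ℝ (WithLp 2 (L2R × L2R)) :=
  (Submodule.span ℝ (WithLp.toLp 2 '' testPairs)).topologicalClosure

theorem mem_testClosure_orthogonal_iff {z : WithLp 2 (L2R × L2R)} :
    z ∈ testClosureᗮ ↔ HasWeakDeriv z.snd z.fst := by
  rw [testClosure, Submodule.orthogonal_closure, Submodule.mem_orthogonal, hasWeakDeriv_iff_inner]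
  constructor
  · intro h p hp
    have h1 := h _ (Submodule.subset_span ⟨p, hp, rfl⟩)
    rw [WithLp.prod_inner_apply] at h1
    have h2 : inner ℝ p.1 z.fst + inner ℝ p.2 z.snd = 0 := h1
    rw [real_inner_comm p.2 z.snd, real_inner_comm p.1 z.fst]
    linarith
  · intro h y hy
    induction hy using Submodule.span_induction with
    | mem y hy =>
      obtain ⟨p, hp, rfl⟩ := hy
      rw [WithLp.prod_inner_apply]
      change inner ℝ p.1 z.fst + inner ℝ p.2 z.snd = 0
      have := h p hp
      rw [real_inner_comm p.2 z.snd, real_inner_comm p.1 z.fst] at this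
      linarith
    | zero => exact inner_zero_left _
    | add x y _ _ hx hy => rw [inner_add_left, hx, hy, add_zero]
    | smul c x _ hx => rw [inner_smul_left, hx, mul_zero]

/-- Test functions are dense in `H¹(ℝ)`: the part `z` of a pair `(u, u')` that is orthogonal to all
test pairs is again a pair `(w, w')`, and `w'' = w`. -/
theorem HasWeakDeriv.mem_testClosure {u v : L2R} (h : HasWeakDeriv u v) :
    WithLp.toLp 2 (u, v) ∈ testClosure := by
  have hcl : ∀ y ∈ testClosure, HasWeakDeriv y.fst y.snd := by
    intro y hy
    have hc : IsClosed {y : WithLp 2 (L2R × L2R) | HasWeakDeriv y.fst y.snd} :=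
      isClosed_hasWeakDeriv.preimage (WithLp.prod_continuous_ofLp 2 L2R L2R)
    refine closure_minimal ?_ hc hy
    intro x hx
    induction hx using Submodule.span_induction with
    | mem y hy =>
      obtain ⟨p, hp, rfl⟩ := hy
      exact hasWeakDeriv_of_mem_testPairs hp
    | zero => exact HasWeakDeriv.zero
    | add x y _ _ hx hy => exact HasWeakDeriv.add hx hy
    | smul c x _ hx => exact HasWeakDeriv.smul c hx
  have : CompleteSpace testClosure :=
    (Submodule.isClosed_topologicalClosure _).completeSpace_coe
  obtain ⟨y, hy, z, hz, hyz⟩ := testClosure.exists_add_mem_mem_orthogonal (WithLp.toLp 2 (u, v))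
  have h1 : HasWeakDeriv z.snd z.fst := mem_testClosure_orthogonal_iff.mp hz
  have h2 : HasWeakDeriv z.fst z.snd := by
    have e : z = WithLp.toLp 2 (u, v) - y := by rw [hyz]; abel
    rw [e]
    exact h.sub (hcl y hy)
  have h3 : z = 0 := WithLp.ofLp_injective 2 (Prod.ext
    (h2.eq_zero_of_deriv_deriv_eq h1) (h1.eq_zero_of_deriv_deriv_eq h2))
  rw [hyz, h3, add_zero]
  exact hy

theorem HasWeakDeriv.inner_eq_neg {u v u' v' : L2R} (h : HasWeakDeriv u v)
    (h' : HasWeakDeriv u' v') : inner ℝ v u' = -inner ℝ u v' := by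
  have h1 : WithLp.toLp 2 (v', u') ∈ testClosureᗮ := mem_testClosure_orthogonal_iff.mpr h'
  have h2 := (Submodule.mem_orthogonal _ _).mp h1 _ h.mem_testClosure
  rw [WithLp.prod_inner_apply] at h2
  have h3 : inner ℝ u v' + inner ℝ v u' = 0 := h2
  linarith

/-! ### Multiplication operators -/

theorem mulOp_coeFn (V : ℝ →ᵇ ℝ) (u : L2R) : ∀ᵐ x, mulOp V u x = V x * u x :=
  (memLp_bounded_mul V u).coeFn_toLp

theorem mulOp_inner_left (V : ℝ →ᵇ ℝ) (u v : L2R) :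
    inner ℝ (mulOp V u) v = inner ℝ u (mulOp V v) := by
  rw [inner_L2R_eq_integral, inner_L2R_eq_integral]
  refine integral_congr_ae ?_
  filter_upwards [mulOp_coeFn V u, mulOp_coeFn V v] with x h1 h2
  rw [h1, h2]
  ring

theorem norm_mulOp_le (V : ℝ →ᵇ ℝ) (u : L2R) : ‖mulOp V u‖ ≤ ‖V‖ * ‖u‖ := by
  have h : ‖mulOp V u‖ ≤ ‖(‖V‖ • u : L2R)‖ := by
    refine Lp.norm_le_norm_of_ae_le ?_
    filter_upwards [mulOp_coeFn V u, Lp.coeFn_smul ‖V‖ u] with x h1 h2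
    rw [h1, h2, Pi.smul_apply, smul_eq_mul, norm_mul, norm_mul, norm_norm]
    exact mul_le_mul_of_nonneg_right (V.norm_coe_le_norm x) (norm_nonneg _)
  rwa [norm_smul, norm_norm] at h

theorem continuous_mulOp (V : ℝ →ᵇ ℝ) : Continuous (mulOp V) :=
  (LinearMap.mkContinuous (mulOp V) ‖V‖ (norm_mulOp_le V)).continuous

theorem contDiff_tanh : ContDiff ℝ ∞ Real.tanh := by
  have e : Real.tanh = fun y => Real.sinh y / Real.cosh y :=
    funext fun y => Real.tanh_eq_sinh_div_cosh y
  rw [e]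
  exact Real.contDiff_sinh.div Real.contDiff_cosh fun x => (Real.cosh_pos x).ne'

theorem sech_sq_eq (x : ℝ) : sech x ^ 2 = 1 - Real.tanh x ^ 2 := by
  rw [sech, Real.tanh_eq_sinh_div_cosh]
  have h := (Real.cosh_pos x).ne'
  have h1 := Real.cosh_sq x
  field_simp
  linarith

theorem hasDerivAt_tanh (x : ℝ) : HasDerivAt Real.tanh (1 - Real.tanh x ^ 2) x := by
  have h := (contDiff_tanh.differentiable (by simp) x).hasDerivAt
  rwa [deriv_tanh_eq, sech_sq_eq] at h

theorem abs_tanh_le_one (x : ℝ) : |Real.tanh x| ≤ 1 := by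
  have h := sech_sq_eq x
  have h1 := sech_pos x
  exact abs_le_one_iff_mul_self_le_one.mpr (by nlinarith)

/-- `φ = tanh` as a bounded continuous function. -/
noncomputable def tanhBdd : ℝ →ᵇ ℝ :=
  BoundedContinuousFunction.ofNormedAddCommGroup Real.tanh contDiff_tanh.continuous 1
    abs_tanh_le_one

/-- Multiplication by `φ = tanh` on `L²(ℝ)`. -/
noncomputable def tanhOp : L2R →ₗ[ℝ] L2R := mulOp tanhBdd

theorem tanhOp_coeFn (u : L2R) : ∀ᵐ x, tanhOp u x = Real.tanh x * u x := mulOp_coeFn tanhBdd u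

theorem tanhOp_inner_left (u v : L2R) : inner ℝ (tanhOp u) v = inner ℝ u (tanhOp v) :=
  mulOp_inner_left _ _ _

theorem mulOp_potential (a b : ℝ) (u : L2R) :
    mulOp (potential a b) u = (b - a) • u + a • tanhOp (tanhOp u) := by
  refine Lp.ext ?_
  filter_upwards [mulOp_coeFn (potential a b) u, tanhOp_coeFn (tanhOp u), tanhOp_coeFn u,
    Lp.coeFn_add ((b - a) • u) (a • tanhOp (tanhOp u)), Lp.coeFn_smul (b - a) u,
    Lp.coeFn_smul a (tanhOp (tanhOp u))] with x h1 h2 h3 h4 h5 h6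
  rw [h1, h4, Pi.add_apply, h5, h6, Pi.smul_apply, Pi.smul_apply, h2, h3, smul_eq_mul, smul_eq_mul]
  change (b - a * sech x ^ 2) * u x = _
  rw [sech_sq_eq]
  ring

/-- The product rule for `φ u`, with `φ' = 1 - φ²`. -/
theorem HasWeakDeriv.tanh_mul {u v : L2R} (h : HasWeakDeriv u v) :
    HasWeakDeriv (tanhOp u) (u - tanhOp (tanhOp u) + tanhOp v) := by
  intro η hη hs
  have hT := contDiff_tanh
  have hdη : Continuous (deriv η) := hη.continuous_deriv (by simp)
  have hd : ∀ x, deriv (fun y => Real.tanh y * η y) x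
      = (1 - Real.tanh x ^ 2) * η x + Real.tanh x * deriv η x := fun x =>
    ((hasDerivAt_tanh x).mul (hη.differentiable (by simp) x).hasDerivAt).deriv
  have h1 := h (fun x => Real.tanh x * η x) (hT.mul hη) hs.mul_left
  simp only [hd, mul_add] at h1
  have hcη : Continuous η := hη.continuous
  have hcT : Continuous Real.tanh := hT.continuous
  have c1 : Continuous fun x => (1 - Real.tanh x ^ 2) * η x := by fun_prop
  have c2 : Continuous fun x => Real.tanh x * deriv η x := by fun_prop
  have c3 : Continuous fun x => Real.tanh x * η x := by fun_prop
  have i1 := integrable_mul_test u c1 hs.mul_left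
  have i2 := integrable_mul_test u c2 hs.deriv.mul_left
  have i3 := integrable_mul_test v c3 hs.mul_left
  rw [integral_add i1 i2] at h1
  have e1 : ∫ x, tanhOp u x * deriv η x = ∫ x, u x * (Real.tanh x * deriv η x) := by
    refine integral_congr_ae ?_
    filter_upwards [tanhOp_coeFn u] with x hx
    rw [hx]
    ring
  have e2 : ∫ x, (u - tanhOp (tanhOp u) + tanhOp v : L2R) x * η x
      = ∫ x, (u x * ((1 - Real.tanh x ^ 2) * η x) + v x * (Real.tanh x * η x)) := by
    refine integral_congr_ae ?_
    filter_upwards [tanhOp_coeFn (tanhOp u), tanhOp_coeFn u, tanhOp_coeFn v,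
      Lp.coeFn_add (u - tanhOp (tanhOp u)) (tanhOp v),
      Lp.coeFn_sub u (tanhOp (tanhOp u))] with x h1 h2 h3 h4 h5
    rw [h4, Pi.add_apply, h5, Pi.sub_apply, h1, h2, h3]
    ring
  rw [e1, e2, integral_add i1 i3]
  linarith

/-! ### Factorization of Pöschl–Teller operators -/

/-- `(∂ + n φ) u = v`, where `φ = tanh`. The formal adjoint of this operator is `-∂ + n φ`, so
`(-∂ + n φ) v = f` reads `Ladder (-n) v (-f)`. -/
def Ladder (n : ℝ) (u v : L2R) : Prop := HasWeakDeriv u (v - n • tanhOp u)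

/-- `(-∂ + n φ) (∂ + n φ) u + k u = f` in factorized form, i.e.
`-u'' - (n² + n) ψ² u + (n² + k) u = f`. -/
def PoschlTeller (n k : ℝ) (u f : L2R) : Prop := ∃ v, Ladder n u v ∧ Ladder (-n) v (k • u - f)

namespace Ladder

variable {n : ℝ} {u v u' v' w z : L2R}

theorem add (h : Ladder n u v) (h' : Ladder n u' v') : Ladder n (u + u') (v + v') := by
  have := HasWeakDeriv.add h h'
  rw [Ladder, map_add]
  convert this using 1
  module

theorem smul (c : ℝ) (h : Ladder n u v) : Ladder n (c • u) (c • v) := by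
  have := HasWeakDeriv.smul c h
  rw [Ladder, map_smul]
  convert this using 1
  module

theorem zero : Ladder n 0 0 := by
  simpa [Ladder] using HasWeakDeriv.zero

theorem neg (h : Ladder n u v) : Ladder n (-u) (-v) := by
  simpa using h.smul (-1)

theorem inner_eq (h : Ladder n u v) (h' : Ladder (-n) w z) : inner ℝ v w = -inner ℝ u z := by
  have h1 := HasWeakDeriv.inner_eq_neg h h'
  rw [inner_sub_left, inner_sub_right, inner_smul_left, inner_smul_right, tanhOp_inner_left] at h1
  simp only [conj_trivial] at h1
  linarith

theorem isClosed (n : ℝ) : IsClosed {p : L2R × L2R | Ladder n p.1 p.2} := by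
  have hT : Continuous tanhOp := continuous_mulOp _
  have hc : Continuous fun p : L2R × L2R => (p.1, p.2 - n • tanhOp p.1) := by fun_prop
  exact isClosed_hasWeakDeriv.preimage hc

end Ladder

/-- Every function with one weak derivative lies in the domain of each `∂ + n φ`. -/
theorem HasWeakDeriv.ladder {u v : L2R} (h : HasWeakDeriv u v) (n : ℝ) :
    Ladder n u (v + n • tanhOp u) := by
  rw [Ladder, add_sub_cancel_right]
  exact h

namespace PoschlTeller

variable {n k : ℝ} {u f u' f' : L2R}

theorem add (h : PoschlTeller n k u f) (h' : PoschlTeller n k u' f') :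
    PoschlTeller n k (u + u') (f + f') := by
  obtain ⟨v, h1, h2⟩ := h
  obtain ⟨v', h1', h2'⟩ := h'
  refine ⟨v + v', h1.add h1', ?_⟩
  convert h2.add h2' using 1
  module

theorem smul (c : ℝ) (h : PoschlTeller n k u f) : PoschlTeller n k (c • u) (c • f) := by
  obtain ⟨v, h1, h2⟩ := h
  refine ⟨c • v, h1.smul c, ?_⟩
  convert h2.smul c using 1
  module

theorem neg (h : PoschlTeller n k u f) : PoschlTeller n k (-u) (-f) := by
  simpa using h.smul (-1)

theorem sub (h : PoschlTeller n k u f) (h' : PoschlTeller n k u' f') :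
    PoschlTeller n k (u - u') (f - f') := by
  simpa [sub_eq_add_neg] using h.add h'.neg

theorem inner_eq (h : PoschlTeller n k u f) (h' : PoschlTeller n k u' f') :
    inner ℝ f u' = inner ℝ u f' := by
  obtain ⟨v, h1, h2⟩ := h
  obtain ⟨v', h1', h2'⟩ := h'
  have e1 := h1.inner_eq h2'
  have e2 := h1'.inner_eq h2
  rw [inner_sub_right, inner_smul_right] at e1 e2
  rw [real_inner_comm, real_inner_comm u u', real_inner_comm f u'] at e2
  linarith

theorem hasWeakDeriv (h : PoschlTeller n k u f) : ∃ v, HasWeakDeriv u v := by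
  obtain ⟨v, h1, -⟩ := h
  exact ⟨_, h1⟩

/-- The quadratic form of the operator. -/
theorem exists_inner_eq (h : PoschlTeller n k u f) :
    ∃ v, Ladder n u v ∧ Ladder (-n) v (k • u - f) ∧ inner ℝ f u = ‖v‖ ^ 2 + k * ‖u‖ ^ 2 := by
  obtain ⟨v, h1, h2⟩ := h
  refine ⟨v, h1, h2, ?_⟩
  have e := h1.inner_eq h2
  rw [inner_sub_right, inner_smul_right, real_inner_self_eq_norm_sq, real_inner_self_eq_norm_sq,
    real_inner_comm] at e
  linarith

theorem mul_norm_sq_le (h : PoschlTeller n k u f) : k * ‖u‖ ^ 2 ≤ inner ℝ f u := by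
  obtain ⟨v, -, -, h⟩ := h.exists_inner_eq
  nlinarith [sq_nonneg ‖v‖]

/-- The factorized form agrees with `-∂² + (n² + k) - (n² + n) ψ²`, so different values of `(n, k)`
with the same potential give the same operator. -/
theorem iff_exists_hasWeakDeriv : PoschlTeller n k u f ↔
    ∃ v w, HasWeakDeriv u v ∧ HasWeakDeriv v w ∧
      mulOp (potential (n ^ 2 + n) (n ^ 2 + k)) u - w = f := by
  rw [mulOp_potential]
  constructor
  · rintro ⟨v, h1, h2⟩
    have h1' : HasWeakDeriv u (v - n • tanhOp u) := h1
    refine ⟨_, _, h1', HasWeakDeriv.sub h2 (h1'.tanh_mul.smul n), ?_⟩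
    rw [map_sub, map_smul]
    module
  · rintro ⟨v, w, h1, h2, h3⟩
    refine ⟨v + n • tanhOp u, h1.ladder n, ?_⟩
    have := h2.add (h1.tanh_mul.smul n)
    rw [Ladder, map_add, map_smul, ← h3]
    convert this using 1
    module

theorem congr {n' k' : ℝ} (h1 : n ^ 2 + n = n' ^ 2 + n') (h2 : n ^ 2 + k = n' ^ 2 + k') :
    PoschlTeller n k u f ↔ PoschlTeller n' k' u f := by
  rw [iff_exists_hasWeakDeriv, iff_exists_hasWeakDeriv, h1, h2]

/-- For `k > 0` the operator is onto: by the projection theorem on the graph of `∂ + n φ`, weighted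
by `√k`. -/
theorem exists_of_pos (n : ℝ) (hk : 0 < k) (g : L2R) : ∃ u, PoschlTeller n k u g := by
  set s := Real.sqrt k with hs
  have hs0 : s ≠ 0 := (Real.sqrt_pos.mpr hk).ne'
  have hss : s * s = k := Real.mul_self_sqrt hk.le
  let G : Submodule ℝ (WithLp 2 (L2R × L2R)) :=
    { carrier := {p | Ladder n (s⁻¹ • p.fst) p.snd}
      add_mem' := fun {a b} ha hb => by
        have h := Ladder.add ha hb
        rw [← smul_add] at h
        exact h
      zero_mem' := by
        have h : Ladder n (s⁻¹ • (0 : L2R)) 0 := by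
          rw [smul_zero]
          exact Ladder.zero
        exact h
      smul_mem' := fun c a ha => by
        have h := Ladder.smul c ha
        rw [smul_comm] at h
        exact h }
  have hG : IsClosed (G : Set (WithLp 2 (L2R × L2R))) := by
    have hc : Continuous fun p : L2R × L2R => (s⁻¹ • p.1, p.2) := by fun_prop
    exact (Ladder.isClosed n).preimage (hc.comp (WithLp.prod_continuous_ofLp 2 L2R L2R))
  have : CompleteSpace G := hG.completeSpace_coe
  obtain ⟨y, hy, z, hz, hyz⟩ := G.exists_add_mem_mem_orthogonal (WithLp.toLp 2 (s⁻¹ • g, (0 : L2R)))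
  have hy' : Ladder n (s⁻¹ • y.fst) y.snd := hy
  have e1 : z.fst = s⁻¹ • g - y.fst := by
    have : s⁻¹ • g = y.fst + z.fst := congrArg WithLp.fst hyz
    rw [this]
    abel
  have e2 : z.snd = -y.snd := by
    have : (0 : L2R) = y.snd + z.snd := congrArg WithLp.snd hyz
    exact eq_neg_of_add_eq_zero_right this.symm
  refine ⟨s⁻¹ • y.fst, y.snd, hy', ?_⟩
  rw [Ladder, hasWeakDeriv_iff_inner]
  intro p hp
  have hp1 := (hasWeakDeriv_of_mem_testPairs hp).ladder n
  have hp2 : WithLp.toLp 2 (s • p.1, p.2 + n • tanhOp p.1) ∈ G := by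
    change Ladder n (s⁻¹ • s • p.1) _
    rw [smul_smul, inv_mul_cancel₀ hs0, one_smul]
    exact hp1
  have h := (Submodule.mem_orthogonal' _ _).mp hz _ hp2
  rw [WithLp.prod_inner_apply] at h
  have h' : inner ℝ z.fst (s • p.1) + inner ℝ z.snd (p.2 + n • tanhOp p.1) = 0 := h
  rw [e1, e2] at h'
  simp only [inner_sub_left, inner_smul_left, inner_smul_right, inner_neg_left, inner_add_right,
    conj_trivial, tanhOp_inner_left] at h' ⊢
  have h3 : s * s⁻¹ = 1 := mul_inv_cancel₀ hs0
  rw [← hss]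
  linear_combination -h' + (inner ℝ g p.1 + s * inner ℝ y.fst p.1) * h3

/-- For `k ≠ 0` the inverse of the operator is expressed by that of the operator with factors
exchanged. -/
theorem of_partner (hk : k ≠ 0) {g w x : L2R} (hf : Ladder n f g)
    (hw : Ladder (-n) w x) (hx : Ladder n x (k • w - g)) :
    PoschlTeller n k (k⁻¹ • (f + x)) f := by
  refine ⟨w, ?_, ?_⟩
  · convert (hf.add hx).smul k⁻¹ using 1
    rw [add_sub_cancel, smul_smul, inv_mul_cancel₀ hk, one_smul]
  · convert hw using 1
    rw [smul_smul, mul_inv_cancel₀ hk, one_smul]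
    abel

/-- If the operator with factors exchanged is onto, then the range of `-∂ + n φ` contains every
function in `H¹(ℝ)` orthogonal to the kernel of `∂ + n φ`. -/
theorem exists_ladder_neg {g : L2R} (hP : ∀ g, ∃ u, PoschlTeller (-n) 0 u g)
    (hf : Ladder n f g) (hker : ∀ z, Ladder n z 0 → inner ℝ z f = 0) :
    ∃ v, Ladder (-n) v (-f) := by
  obtain ⟨v, x, h1, h2⟩ := hP g
  rw [neg_neg, zero_smul, zero_sub] at h2
  have h3 : Ladder n (x + f) 0 := by
    simpa using h2.add hf
  have h4 := h3.inner_eq h1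
  rw [inner_zero_left, zero_eq_neg] at h4
  have h5 := hker _ h3
  have h6 : x + f = 0 := by
    rw [← inner_self_eq_zero (𝕜 := ℝ), inner_add_right, h4, h5, add_zero]
  rw [eq_neg_of_add_eq_zero_left h6] at h1
  exact ⟨v, h1⟩

theorem exists_of_orthogonal {g : L2R} (hP : ∀ g, ∃ u, PoschlTeller (-n) 0 u g)
    (hf : Ladder n f g) (hker : ∀ z, Ladder n z 0 → inner ℝ z f = 0) :
    ∃ u, PoschlTeller n 0 u f := by
  obtain ⟨v, hv⟩ := exists_ladder_neg hP hf hker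
  obtain ⟨w, y, h1, h2⟩ := hP v
  rw [neg_neg, zero_smul, zero_sub] at h2
  refine ⟨-y, v, by simpa using h2.neg, by simpa using hv⟩

/-- A lower bound `m` of the operator with factors exchanged bounds `-∂ + n φ` from below. -/
theorem mul_norm_sq_le_of_ladder_neg {m : ℝ} {v x y : L2R}
    (hP : ∀ u f, PoschlTeller (-n) 0 u f → m * ‖u‖ ^ 2 ≤ inner ℝ f u)
    (hv : Ladder (-n) v x) (hx : Ladder n x y) : m * ‖v‖ ^ 2 ≤ ‖x‖ ^ 2 := by
  have h : PoschlTeller (-n) 0 v (-y) := ⟨x, hv, by simpa using hx⟩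
  have h1 := hP _ _ h
  have h2 := hx.inner_eq hv
  rw [real_inner_self_eq_norm_sq] at h2
  rw [inner_neg_left] at h1
  linarith

/-- A lower bound `m > 0` of the operator with factors exchanged bounds `∂ + n φ` from below on the
orthogonal complement of its kernel. -/
theorem mul_norm_sq_le_of_orthogonal {m : ℝ} (hm : 0 < m) {t g : L2R}
    (hS : ∀ g, ∃ u, PoschlTeller (-n) 0 u g)
    (hP : ∀ u f, PoschlTeller (-n) 0 u f → m * ‖u‖ ^ 2 ≤ inner ℝ f u)
    (ht : Ladder n t g) (hker : ∀ z, Ladder n z 0 → inner ℝ z t = 0) :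
    m * ‖t‖ ^ 2 ≤ ‖g‖ ^ 2 := by
  obtain ⟨v, hv⟩ := exists_ladder_neg hS ht hker
  have h1 := mul_norm_sq_le_of_ladder_neg hP hv ht.neg
  have h2 := ht.inner_eq hv
  rw [inner_neg_right, neg_neg, real_inner_self_eq_norm_sq] at h2
  rw [norm_neg] at h1
  have h3 : ‖t‖ ^ 2 ≤ ‖g‖ * ‖v‖ := h2 ▸ real_inner_le_norm g v
  by_cases h0 : ‖t‖ = 0
  · rw [h0]
    nlinarith [sq_nonneg ‖g‖]
  have h4 : 0 < ‖t‖ ^ 2 := by positivity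
  have h5 : (m * ‖t‖ ^ 2) * ‖t‖ ^ 2 ≤ ‖g‖ ^ 2 * ‖t‖ ^ 2 := by
    calc (m * ‖t‖ ^ 2) * ‖t‖ ^ 2 = m * (‖t‖ ^ 2) ^ 2 := by ring
      _ ≤ m * (‖g‖ * ‖v‖) ^ 2 := by gcongr
      _ = ‖g‖ ^ 2 * (m * ‖v‖ ^ 2) := by ring
      _ ≤ ‖g‖ ^ 2 * ‖t‖ ^ 2 := by gcongr
  exact le_of_mul_le_mul_right h5 h4

end PoschlTeller

/-! ### The operators `C` and `D` in factorized form -/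

theorem schrodinger_iff (V : ℝ →ᵇ ℝ) (u f : L2R) :
    (∃ x : (schrodinger V).domain, (x : L2R) = u ∧ schrodinger V x = f) ↔
      ∃ v w, HasWeakDeriv u v ∧ HasWeakDeriv v w ∧ mulOp V u - w = f := by
  constructor
  · rintro ⟨x, rfl, rfl⟩
    have hx : (x : L2R) ∈ secondDeriv.domain := x.2
    have h : ((x : L2R), secondDeriv ⟨x, hx⟩) ∈ secondDeriv.graph := secondDeriv.mem_graph ⟨x, hx⟩
    rw [secondDeriv_graph] at h
    obtain ⟨v, h1, h2⟩ := h
    refine ⟨v, _, h1, h2, ?_⟩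
    rw [sub_eq_add_neg]
    rfl
  · rintro ⟨v, w, h1, h2, rfl⟩
    have h : (u, w) ∈ secondDeriv.graph := by
      rw [secondDeriv_graph]
      exact ⟨v, h1, h2⟩
    obtain ⟨y, hy, hyw⟩ := (LinearPMap.mem_graph_iff _).mp h
    refine ⟨⟨(y : L2R), y.2⟩, hy, ?_⟩
    have hy' : (y : L2R) = u := hy
    have hyw' : secondDeriv y = w := hyw
    rw [← hy', ← hyw', sub_eq_add_neg]
    rfl

theorem opC_iff (u f : L2R) :
    (∃ x : opC.domain, (x : L2R) = u ∧ opC x = f) ↔ PoschlTeller 2 0 u f := by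
  rw [PoschlTeller.iff_exists_hasWeakDeriv, ← schrodinger_iff,
    show (2 : ℝ) ^ 2 + 2 = 6 by norm_num, show (2 : ℝ) ^ 2 + 0 = 4 by norm_num]
  rfl

theorem opD_iff (μ : ℝ) (u f : L2R) :
    (∃ x : (opD μ).domain, (x : L2R) = u ∧ opD μ x = f) ↔ PoschlTeller 1 μ u f := by
  rw [PoschlTeller.iff_exists_hasWeakDeriv, ← schrodinger_iff,
    show (1 : ℝ) ^ 2 + 1 = 2 by norm_num, show (1 : ℝ) ^ 2 + μ = μ + 1 by ring]
  rfl

theorem opD_spec {μ : ℝ} (x : (opD μ).domain) : PoschlTeller 1 μ (x : L2R) (opD μ x) :=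
  (opD_iff μ _ _).mp ⟨x, rfl, rfl⟩

/-! ### The kernels of `∂ + φ` and `∂ + 2φ` -/

/-- The kernel of `∂ + n φ` is spanned by `ψⁿ`. -/
theorem Ladder.exists_ae_eq_sech_pow {n : ℕ} {z : L2R} (h : Ladder n z 0) :
    ∃ c : ℝ, ∀ᵐ x, z x = c * sech x ^ n := by
  have hd : ∀ x, HasDerivAt (fun y => Real.cosh y ^ n)
      (n * Real.cosh x ^ (n - 1) * Real.sinh x) x := fun x => (Real.hasDerivAt_cosh x).pow n
  rw [Ladder, zero_sub] at h
  obtain ⟨c, hc⟩ := h.ae_mul_eq_const (a := fun x => Real.cosh x ^ n) (by fun_prop) (by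
    filter_upwards [Lp.coeFn_neg ((n : ℝ) • tanhOp z), Lp.coeFn_smul (n : ℝ) (tanhOp z),
      tanhOp_coeFn z] with x h1 h2 h3
    rw [h1, Pi.neg_apply, h2, Pi.smul_apply, h3, smul_eq_mul, (hd x).deriv,
      Real.tanh_eq_sinh_div_cosh]
    have hx := (Real.cosh_pos x).ne'
    rcases n with _ | n
    · simp
    · rw [Nat.add_sub_cancel, pow_succ]
      field_simp)
  refine ⟨c, ?_⟩
  filter_upwards [hc] with x hx
  have hx' := (Real.cosh_pos x).ne'
  rw [← hx, sech, inv_pow]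
  field_simp

theorem hasDerivAt_sech (x : ℝ) : HasDerivAt sech (-(Real.tanh x * sech x)) x := by
  have h := (Real.hasDerivAt_cosh x).inv (Real.cosh_pos x).ne'
  refine HasDerivAt.congr_deriv h ?_
  have hx := (Real.cosh_pos x).ne'
  rw [sech, Real.tanh_eq_sinh_div_cosh]
  field_simp

/-- A classical solution of `f' = -n φ f` in `L²(ℝ)` lies in the kernel of `∂ + n φ`. -/
theorem ladder_toLp_zero {n : ℝ} {f : ℝ → ℝ} (hf : MemLp f 2 (volume : Measure ℝ))
    (h : ∀ x, HasDerivAt f (-(n * (Real.tanh x * f x))) x) : Ladder n (hf.toLp f) 0 := by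
  have e : (fun x => -(n * (Real.tanh x * f x))) =ᵐ[volume]
      ((-n) • tanhOp (hf.toLp f) : L2R) := by
    filter_upwards [Lp.coeFn_smul (-n) (tanhOp (hf.toLp f)), tanhOp_coeFn (hf.toLp f),
      hf.coeFn_toLp] with x h1 h2 h3
    rw [h1, Pi.smul_apply, h2, h3, smul_eq_mul]
    ring
  have hf' : MemLp (fun x => -(n * (Real.tanh x * f x))) 2 (volume : Measure ℝ) :=
    (memLp_congr_ae e).mpr (Lp.memLp _)
  have h1 := hasWeakDeriv_toLp hf hf' h
  have h2 : hf'.toLp _ = (-n) • tanhOp (hf.toLp f) :=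
    Lp.ext (hf'.coeFn_toLp.trans e)
  rw [h2] at h1
  rw [Ladder, zero_sub, ← neg_smul]
  exact h1

theorem ladder_psi : Ladder 1 psi 0 :=
  ladder_toLp_zero memLp_sech fun x => by simpa using hasDerivAt_sech x

theorem ladder_dphi : Ladder 2 dphi 0 := by
  refine ladder_toLp_zero memLp_deriv_tanh fun x => ?_
  rw [deriv_tanh_eq, show deriv Real.tanh = fun x => sech x ^ 2 from funext deriv_tanh_eq]
  refine HasDerivAt.congr_deriv ((hasDerivAt_sech x).fun_pow 2) ?_
  push_cast
  ring

theorem Ladder.exists_eq_smul_psi {z : L2R} (h : Ladder 1 z 0) : ∃ c : ℝ, z = c • psi := by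
  obtain ⟨c, hc⟩ := Ladder.exists_ae_eq_sech_pow (n := 1) (by simpa using h)
  refine ⟨c, Lp.ext ?_⟩
  filter_upwards [hc, Lp.coeFn_smul c psi, memLp_sech.coeFn_toLp] with x h1 h2 h3
  rw [h1, h2, Pi.smul_apply, smul_eq_mul, psi, h3, pow_one]

theorem Ladder.exists_eq_smul_dphi {z : L2R} (h : Ladder 2 z 0) : ∃ c : ℝ, z = c • dphi := by
  obtain ⟨c, hc⟩ := Ladder.exists_ae_eq_sech_pow (n := 2) (by simpa using h)
  refine ⟨c, Lp.ext ?_⟩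
  filter_upwards [hc, Lp.coeFn_smul c dphi, memLp_deriv_tanh.coeFn_toLp] with x h1 h2 h3
  rw [h1, h2, Pi.smul_apply, smul_eq_mul, dphi, h3, deriv_tanh_eq]

theorem inner_psi_dphi_pos : 0 < inner ℝ psi dphi := by
  have e : inner ℝ psi dphi = ∫ x, sech x ^ 3 := by
    rw [inner_L2R_eq_integral]
    refine integral_congr_ae ?_
    filter_upwards [memLp_sech.coeFn_toLp, memLp_deriv_tanh.coeFn_toLp] with x h1 h2
    rw [psi, dphi, h1, h2, deriv_tanh_eq]
    ring
  have hi : Integrable (fun x => sech x ^ 3) := by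
    have h := memLp_sech.integrable_mul memLp_deriv_tanh
    refine h.congr (Eventually.of_forall fun x => ?_)
    rw [Pi.mul_apply, deriv_tanh_eq]
    ring
  have hs : Function.support (fun x => sech x ^ 3) = Set.univ :=
    Set.eq_univ_of_forall fun x => pow_ne_zero 3 (sech_pos x).ne'
  rw [e, integral_pos_iff_support_of_nonneg (fun x => pow_nonneg (sech_pos x).le 3) hi, hs]
  simp

theorem psi_ne_zero : psi ≠ 0 := fun h => by
  have := inner_psi_dphi_pos
  rw [h, inner_zero_left] at this
  exact lt_irrefl _ this

theorem dphi_ne_zero : dphi ≠ 0 := fun h => by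
  have := inner_psi_dphi_pos
  rw [h, inner_zero_right] at this
  exact lt_irrefl _ this

theorem PoschlTeller.ladder_of_zero {n : ℝ} {z : L2R} (h : PoschlTeller n 0 z 0) :
    Ladder n z 0 := by
  obtain ⟨v, h1, -, h2⟩ := h.exists_inner_eq
  rw [inner_zero_left, zero_mul, add_zero] at h2
  rwa [norm_eq_zero.mp (pow_eq_zero_iff two_ne_zero |>.mp h2.symm)] at h1

theorem poschlTeller_of_ladder {n k : ℝ} {z : L2R} (h : Ladder n z 0) :
    PoschlTeller n k z (k • z) := by
  refine ⟨0, h, ?_⟩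
  rw [sub_self]
  exact Ladder.zero

/-! ### Solvability -/

theorem exists_poschlTeller_neg_one {μ : ℝ} (hμ : -1 < μ) (g : L2R) :
    ∃ u, PoschlTeller (-1) μ u g := by
  obtain ⟨u, hu⟩ := PoschlTeller.exists_of_pos (k := 1 + μ) 0 (by linarith) g
  exact ⟨u, (PoschlTeller.congr (by norm_num) (by norm_num)).mp hu⟩

theorem exists_poschlTeller_neg_two (g : L2R) : ∃ u, PoschlTeller (-2) 0 u g := by
  obtain ⟨u, hu⟩ := PoschlTeller.exists_of_pos (k := 3) 1 (by norm_num) g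
  exact ⟨u, (PoschlTeller.congr (by norm_num) (by norm_num)).mp hu⟩

theorem norm_sq_le_of_poschlTeller_neg_one (u f : L2R) (h : PoschlTeller (-1) 0 u f) :
    1 * ‖u‖ ^ 2 ≤ inner ℝ f u :=
  ((PoschlTeller.congr (n' := 0) (k' := 1) (by norm_num) (by norm_num)).mp h).mul_norm_sq_le

theorem norm_sq_le_of_poschlTeller_neg_two (u f : L2R) (h : PoschlTeller (-2) 0 u f) :
    3 * ‖u‖ ^ 2 ≤ inner ℝ f u :=
  ((PoschlTeller.congr (n' := 1) (k' := 3) (by norm_num) (by norm_num)).mp h).mul_norm_sq_le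

/-- For `μ ≠ 0` the range of `D` contains `H¹(ℝ)`. -/
theorem exists_poschlTeller_one {μ : ℝ} (hμ : -1 < μ) (h0 : μ ≠ 0) {f f' : L2R}
    (hf : HasWeakDeriv f f') : ∃ r, PoschlTeller 1 μ r f := by
  obtain ⟨w, x, h1, h2⟩ := exists_poschlTeller_neg_one hμ (f' + (1 : ℝ) • tanhOp f)
  rw [neg_neg] at h2
  exact ⟨_, PoschlTeller.of_partner h0 (hf.ladder 1) h1 h2⟩

theorem PoschlTeller.unique_one {μ : ℝ} (hμ : -1 < μ) (h0 : μ ≠ 0) {r r' f : L2R}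
    (h : PoschlTeller 1 μ r f) (h' : PoschlTeller 1 μ r' f) : r = r' := by
  have h1 := h.sub h'
  rw [sub_self] at h1
  obtain ⟨_, h2⟩ := h1.hasWeakDeriv
  obtain ⟨s, hs⟩ := exists_poschlTeller_one hμ h0 h2
  have h3 := h1.inner_eq hs
  rw [inner_zero_left] at h3
  exact sub_eq_zero.mp (inner_self_eq_zero.mp h3.symm)

/-- At `μ = 0` the range of `D` contains every function in `H¹(ℝ)` orthogonal to `ψ`. -/
theorem exists_poschlTeller_one_zero {f f' : L2R} (hf : HasWeakDeriv f f')
    (h : inner ℝ f psi = 0) : ∃ r, PoschlTeller 1 0 r f := by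
  refine PoschlTeller.exists_of_orthogonal (exists_poschlTeller_neg_one (by norm_num))
    (hf.ladder 1) fun z hz => ?_
  obtain ⟨c, rfl⟩ := hz.exists_eq_smul_psi
  rw [inner_smul_left, real_inner_comm, h, mul_zero]

/-- The range of `C` contains every function in `H¹(ℝ)` orthogonal to `φ'`. -/
theorem exists_poschlTeller_two {f f' : L2R} (hf : HasWeakDeriv f f')
    (h : inner ℝ f dphi = 0) : ∃ p, PoschlTeller 2 0 p f := by
  refine PoschlTeller.exists_of_orthogonal exists_poschlTeller_neg_two
    (hf.ladder 2) fun z hz => ?_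
  obtain ⟨c, rfl⟩ := hz.exists_eq_smul_dphi
  rw [inner_smul_left, real_inner_comm, h, mul_zero]

theorem PoschlTeller.unique_two {p p' f : L2R} (h : PoschlTeller 2 0 p f)
    (h' : PoschlTeller 2 0 p' f) (hp : inner ℝ p dphi = 0) (hp' : inner ℝ p' dphi = 0) :
    p = p' := by
  have h1 := h.sub h'
  rw [sub_self] at h1
  obtain ⟨c, hc⟩ := h1.ladder_of_zero.exists_eq_smul_dphi
  have h2 : inner ℝ (p - p') (p - p') = 0 := by
    nth_rewrite 2 [hc]
    rw [inner_smul_right, inner_sub_left, hp, hp', sub_self, mul_zero]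
  exact sub_eq_zero.mp (inner_self_eq_zero.mp h2)

theorem PoschlTeller.inner_dphi_eq_zero {p f : L2R} (h : PoschlTeller 2 0 p f) :
    inner ℝ f dphi = 0 := by
  have h1 := h.inner_eq (poschlTeller_of_ladder (k := 0) ladder_dphi)
  rwa [zero_smul, inner_zero_right] at h1

theorem PoschlTeller.inner_psi {μ : ℝ} {r f : L2R} (h : PoschlTeller 1 μ r f) :
    inner ℝ f psi = μ * inner ℝ r psi := by
  have h1 := h.inner_eq (poschlTeller_of_ladder (k := μ) ladder_psi)
  rwa [inner_smul_right] at h1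

/-- Subtracting a multiple of `φ'` makes the solution of `C p = f` orthogonal to `φ'`. -/
theorem exists_poschlTeller_two_orthogonal {f f' : L2R} (hf : HasWeakDeriv f f')
    (h : inner ℝ f dphi = 0) : ∃ p, PoschlTeller 2 0 p f ∧ inner ℝ p dphi = 0 := by
  obtain ⟨p, hp⟩ := exists_poschlTeller_two hf h
  have h0 : inner ℝ dphi dphi ≠ 0 := inner_self_ne_zero.mpr dphi_ne_zero
  refine ⟨p - (inner ℝ p dphi / inner ℝ dphi dphi) • dphi, ?_, ?_⟩
  · simpa using hp.sub
      ((poschlTeller_of_ladder (k := 0) ladder_dphi).smul (inner ℝ p dphi / inner ℝ dphi dphi))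
  · rw [inner_sub_left, inner_smul_left]
    simp only [conj_trivial]
    field_simp
    ring

theorem hasWeakDeriv_dphi : HasWeakDeriv dphi (-(2 : ℝ) • tanhOp dphi) := by
  have h := ladder_dphi
  rwa [Ladder, zero_sub, ← neg_smul] at h

/-- The quantity `μ ⟨D⁻¹ φ', φ'⟩` is close to `‖φ'‖²`: with `g = (∂ + φ) φ'` it equals
`‖φ'‖² - ⟨(-∂² + 1 + μ)⁻¹ g, g⟩`, and since `g = (φ' / 2)'` the subtracted term lies between `0` and
`‖φ'‖² / 4`. This fixes the sign of `⟨D⁻¹ φ', φ'⟩` on both sides of `μ = 0`. -/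
theorem exists_poschlTeller_one_dphi {μ : ℝ} (hμ : -1 < μ) (h0 : μ ≠ 0) :
    ∃ r, PoschlTeller 1 μ r dphi ∧ 3 / 4 * ‖dphi‖ ^ 2 ≤ μ * inner ℝ r dphi := by
  set g : L2R := -tanhOp dphi with hg
  have hl : Ladder 1 dphi g := by
    rw [Ladder, hg]
    convert hasWeakDeriv_dphi using 1
    module
  obtain ⟨w, hw⟩ := exists_poschlTeller_neg_one hμ g
  have hw0 : PoschlTeller 0 (1 + μ) w g := (PoschlTeller.congr (by norm_num) (by norm_num)).mp hw
  obtain ⟨x, h1, h2⟩ := hw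
  rw [neg_neg] at h2
  refine ⟨_, PoschlTeller.of_partner h0 hl h1 h2, ?_⟩
  obtain ⟨v, h3, -, h4⟩ := hw0.exists_inner_eq
  have h5 := hl.inner_eq h1
  have h6 : Ladder 0 ((1 / 2 : ℝ) • dphi) g := by
    rw [Ladder, hg]
    convert hasWeakDeriv_dphi.smul (1 / 2) using 1
    module
  have h7 := h6.inner_eq (w := w) (z := v) (by rwa [neg_zero])
  rw [inner_smul_left] at h7
  simp only [conj_trivial] at h7
  have h8 := abs_real_inner_le_norm dphi v
  rw [inner_smul_left, inner_add_left, real_inner_self_eq_norm_sq, real_inner_comm]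
  simp only [conj_trivial]
  rw [mul_inv_cancel_left₀ h0]
  -- `w' = v` and `‖v‖² ≤ ⟨g, w⟩ = -⟨φ' / 2, v⟩ ≤ ‖φ'‖ ‖v‖ / 2`, so that `⟨g, w⟩ ≤ ‖φ'‖² / 4`
  have h9 : ‖v‖ ^ 2 ≤ inner ℝ g w := by nlinarith [sq_nonneg ‖w‖]
  have h10 := neg_abs_le (inner ℝ dphi v)
  have h11 : inner ℝ g w ≤ 1 / 2 * (‖dphi‖ * ‖v‖) := by linarith
  nlinarith [sq_nonneg (‖dphi‖ - 2 * ‖v‖)]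

/-! ### The coefficients and the solvability conditions -/

theorem invD_spec {μ : ℝ} (hμ : -1 < μ) (h0 : μ ≠ 0) :
    PoschlTeller 1 μ (invD μ dphi) dphi := by
  have h : ∃ u : (opD μ).domain, (u : L2R) ∈ (⊤ : Submodule ℝ L2R) ∧ opD μ u = dphi := by
    obtain ⟨r, hr⟩ := exists_poschlTeller_one hμ h0 hasWeakDeriv_dphi
    obtain ⟨x, -, hx⟩ := (opD_iff μ r dphi).mpr hr
    exact ⟨x, trivial, hx⟩
  have e : invD μ dphi = (h.choose : L2R) := dif_pos h
  rw [e]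
  exact (opD_iff μ _ _).mp ⟨h.choose, rfl, h.choose_spec.2⟩

theorem invC_spec {f f' : L2R} (hf : HasWeakDeriv f f') (hfo : inner ℝ f dphi = 0) :
    PoschlTeller 2 0 (invC f) f ∧ inner ℝ (invC f) dphi = 0 := by
  have h : ∃ u : opC.domain, (u : L2R) ∈ (ℝ ∙ dphi)ᗮ ∧ opC u = f := by
    obtain ⟨p, hp, hpo⟩ := exists_poschlTeller_two_orthogonal hf hfo
    obtain ⟨x, hx, hxf⟩ := (opC_iff p f).mpr hp
    refine ⟨x, ?_, hxf⟩
    rw [hx, Submodule.mem_orthogonal_singleton_iff_inner_left]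
    exact hpo
  have e : invC f = (h.choose : L2R) := dif_pos h
  rw [e]
  exact ⟨(opC_iff _ _).mp ⟨h.choose, rfl, h.choose_spec.2⟩,
    Submodule.mem_orthogonal_singleton_iff_inner_left.mp h.choose_spec.1⟩

theorem norm_dphi_sq_pos : 0 < ‖dphi‖ ^ 2 := by
  have := norm_pos_iff.mpr dphi_ne_zero
  positivity

theorem le_mul_inner_invD {μ : ℝ} (hμ : -1 < μ) (h0 : μ ≠ 0) :
    3 / 4 * ‖dphi‖ ^ 2 ≤ μ * inner ℝ (invD μ dphi) dphi := by
  obtain ⟨r, hr, h⟩ := exists_poschlTeller_one_dphi hμ h0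
  rwa [(invD_spec hμ h0).unique_one hμ h0 hr]

theorem mul_inner_invD_pos {μ : ℝ} (hμ : -1 < μ) (h0 : μ ≠ 0) :
    0 < μ * inner ℝ (invD μ dphi) dphi := by
  linarith [le_mul_inner_invD hμ h0, norm_dphi_sq_pos]

theorem inner_invD_ne_zero {μ : ℝ} (hμ : -1 < μ) (h0 : μ ≠ 0) :
    inner ℝ (invD μ dphi) dphi ≠ 0 := fun h => by
  have := mul_inner_invD_pos hμ h0
  rw [h, mul_zero] at this
  exact lt_irrefl _ this

section Coefficients

variable {β μ : ℝ}

theorem alpha0_mul (hβ : 0 < β) (hμ : -1 < μ) (h0 : μ ≠ 0) :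
    alpha0 β μ * (β * inner ℝ (invD μ dphi) dphi) = ‖dphi‖ ^ 2 := by
  rw [alpha0, if_neg h0, div_mul_cancel₀]
  exact mul_ne_zero hβ.ne' (inner_invD_ne_zero hμ h0)

theorem sign_alpha0 (hβ : 0 < β) (hμ : -1 < μ) :
    SignType.sign (alpha0 β μ) = SignType.sign μ := by
  by_cases h0 : μ = 0
  · rw [alpha0, if_pos h0, h0]
  have h1 := mul_inner_invD_pos hμ h0
  have h2 := norm_dphi_sq_pos
  rw [alpha0, if_neg h0]
  rcases lt_or_gt_of_ne h0 with h | h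
  · have h3 : inner ℝ (invD μ dphi) dphi < 0 := by nlinarith
    rw [sign_neg h, sign_neg (div_neg_of_pos_of_neg h2 (mul_neg_of_pos_of_neg hβ h3))]
  · have h3 : 0 < inner ℝ (invD μ dphi) dphi := by nlinarith
    rw [sign_pos h, sign_pos (div_pos h2 (mul_pos hβ h3))]

theorem abs_mul_alpha0_le (hβ : 0 < β) (hμ : -1 < μ) : |β * alpha0 β μ| ≤ 4 / 3 * |μ| := by
  by_cases h0 : μ = 0
  · rw [alpha0, if_pos h0, h0]
    simp
  have h1 := le_mul_inner_invD hμ h0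
  have h2 := alpha0_mul hβ hμ h0
  have h3 : 0 < |inner ℝ (invD μ dphi) dphi| := abs_pos.mpr (inner_invD_ne_zero hμ h0)
  have h4 := le_abs_self (μ * inner ℝ (invD μ dphi) dphi)
  have h5 : |β * alpha0 β μ| * |inner ℝ (invD μ dphi) dphi| = ‖dphi‖ ^ 2 := by
    rw [← abs_mul, ← abs_of_pos norm_dphi_sq_pos, ← h2]
    congr 1
    ring
  rw [abs_mul] at h4
  refine le_of_mul_le_mul_right ?_ h3
  linarith

theorem qBar1_spec (hβ : 0 < β) (hμ : -1 < μ) :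
    PoschlTeller 1 μ (qBar1 β μ) (alpha0 β μ • dphi) ∧
      β * inner ℝ (qBar1 β μ) dphi = ‖dphi‖ ^ 2 := by
  by_cases h0 : μ = 0
  · have hJ : inner ℝ dphi psi ≠ 0 := by
      rw [real_inner_comm]
      exact inner_psi_dphi_pos.ne'
    rw [qBar1, alpha0, if_pos h0, if_pos h0, h0, zero_smul]
    constructor
    · simpa using (poschlTeller_of_ladder (k := 0) ladder_psi).smul
        (‖dphi‖ ^ 2 / (β * inner ℝ dphi psi))
    · rw [real_inner_smul_left, real_inner_comm dphi psi]
      field_simp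
  · rw [qBar1, if_neg h0]
    refine ⟨(invD_spec hμ h0).smul _, ?_⟩
    rw [inner_smul_left, ← alpha0_mul hβ hμ h0]
    simp only [conj_trivial]
    ring

theorem pBar1_spec (hβ : 0 < β) (hμ : -1 < μ) :
    PoschlTeller 2 0 (pBar1 β μ) (dphi - β • qBar1 β μ) ∧ inner ℝ (pBar1 β μ) dphi = 0 := by
  obtain ⟨hq, hqi⟩ := qBar1_spec hβ hμ
  obtain ⟨_, hd⟩ := hq.hasWeakDeriv
  refine invC_spec (hasWeakDeriv_dphi.sub (hd.smul β)) ?_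
  rw [inner_sub_left, inner_smul_left, real_inner_self_eq_norm_sq]
  simp only [conj_trivial]
  rw [hqi, sub_self]

theorem exists_opL_iff {p q : L2R} {F : L2R × L2R} :
    (∃ U : opC.domain × (opD μ).domain,
      ((U.1 : L2R), (U.2 : L2R)) = (p, q) ∧ opL β μ U = F) ↔
    PoschlTeller 1 μ q F.1 ∧ PoschlTeller 2 0 p (-F.2 - β • q) := by
  rw [← opD_iff, ← opC_iff]
  constructor
  · rintro ⟨⟨x, y⟩, h, rfl⟩
    obtain ⟨rfl, rfl⟩ := Prod.mk.inj h
    refine ⟨⟨y, rfl, rfl⟩, ⟨x, rfl, ?_⟩⟩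
    simp only [opL]
    abel
  · rintro ⟨⟨y, rfl, hy⟩, ⟨x, rfl, hx⟩⟩
    refine ⟨(x, y), rfl, Prod.ext hy ?_⟩
    simp only [opL, hx]
    abel

theorem exists_opL_eq_iff {F : L2R × L2R} :
    (∃ U : opC.domain × (opD μ).domain, opL β μ U = F) ↔
    ∃ p q, PoschlTeller 1 μ q F.1 ∧ PoschlTeller 2 0 p (-F.2 - β • q) := by
  simp only [← exists_opL_iff]
  constructor
  · rintro ⟨U, hU⟩
    exact ⟨U.1, U.2, U, rfl, hU⟩
  · rintro ⟨p, q, U, -, hU⟩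
    exact ⟨U, hU⟩

/-- The Fredholm alternative: for right-hand sides in `H¹(ℝ)²`, the equation `L U = F` is solvable
if and only if `F` is orthogonal to `Ψ₀†`. -/
theorem exists_opL_eq_iff_pairing (hβ : 0 < β) (hμ : -1 < μ) {F G : L2R × L2R}
    (h1 : HasWeakDeriv F.1 G.1) (h2 : HasWeakDeriv F.2 G.2) :
    (∃ U : opC.domain × (opD μ).domain, opL β μ U = F) ↔
      pairing F (adjointKernel β μ) = 0 := by
  rw [exists_opL_eq_iff]
  have key : ∀ q, (∃ p, PoschlTeller 2 0 p (-F.2 - β • q)) → inner ℝ F.2 dphi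
      = -(β * inner ℝ q dphi) := by
    rintro q ⟨p, hp⟩
    have := hp.inner_dphi_eq_zero
    rw [inner_sub_left, inner_neg_left, inner_smul_left] at this
    simp only [conj_trivial] at this
    linarith
  have key' : ∀ q, PoschlTeller 1 μ q F.1 → inner ℝ F.2 dphi = -(β * inner ℝ q dphi) →
      ∃ p, PoschlTeller 2 0 p (-F.2 - β • q) := by
    intro q hq h
    obtain ⟨_, hd⟩ := hq.hasWeakDeriv
    refine exists_poschlTeller_two (h2.neg.sub (hd.smul β)) ?_
    rw [inner_sub_left, inner_neg_left, inner_smul_left]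
    simp only [conj_trivial]
    linarith
  by_cases h0 : μ = 0
  · rw [pairing, adjointKernel, if_pos h0, inner_zero_right, add_zero]
    subst h0
    constructor
    · rintro ⟨p, q, hq, -⟩
      rw [hq.inner_psi, zero_mul]
    · intro h
      obtain ⟨q, hq⟩ := exists_poschlTeller_one_zero h1 h
      -- the free multiple of `ψ` in `q` is used to solve the equation for `p`
      set c := -(inner ℝ F.2 dphi + β * inner ℝ q dphi) / (β * inner ℝ psi dphi) with hc
      have hq' : PoschlTeller 1 0 (q + c • psi) F.1 := by
        simpa using hq.add ((poschlTeller_of_ladder (k := 0) ladder_psi).smul c)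
      obtain ⟨p, hp⟩ := key' _ hq' (by
        have := inner_psi_dphi_pos.ne'
        rw [inner_add_left, inner_smul_left, hc]
        simp only [conj_trivial]
        field_simp
        ring)
      exact ⟨p, _, hq', hp⟩
  · rw [pairing, adjointKernel, if_neg h0, inner_smul_right]
    have hr : ∀ q, PoschlTeller 1 μ q F.1 → inner ℝ F.1 (invD μ dphi) = inner ℝ q dphi :=
      fun q hq => hq.inner_eq (invD_spec hμ h0)
    constructor
    · rintro ⟨p, q, hq, hp⟩
      rw [hr q hq, key q ⟨p, hp⟩]
      ring
    · intro h
      obtain ⟨q, hq⟩ := exists_poschlTeller_one hμ h0 h1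
      rw [hr q hq] at h
      obtain ⟨p, hp⟩ := key' q hq (by linarith)
      exact ⟨p, q, hq, hp⟩

theorem pairing_dphi_ne_zero (hβ : 0 < β) (hμ : -1 < μ) :
    pairing (dphi, 0) (adjointKernel β μ) ≠ 0 := by
  rw [pairing, inner_zero_left, add_zero, real_inner_comm, adjointKernel]
  split_ifs with h0
  · exact inner_psi_dphi_pos.ne'
  · rw [inner_smul_left]
    exact mul_ne_zero hβ.ne' (inner_invD_ne_zero hμ h0)

theorem pairing_sub (F F' G : L2R × L2R) :
    pairing (F - F') G = pairing F G - pairing F' G := by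
  simp only [pairing, Prod.fst_sub, Prod.snd_sub, inner_sub_left]
  ring

theorem pairing_smul (c : ℝ) (F G : L2R × L2R) : pairing (c • F) G = c * pairing F G := by
  simp only [pairing, Prod.smul_fst, Prod.smul_snd, inner_smul_left, conj_trivial]
  ring

/-- Pairing the first order equation with `Ψ₀†`. -/
theorem pairing_first_order (hβ : 0 < β) (hμ : -1 < μ) :
    pairing (0, dphi) (adjointKernel β μ)
      = alpha0 β μ * pairing (dphi, 0) (adjointKernel β μ) := by
  by_cases h0 : μ = 0
  · simp [pairing, adjointKernel, alpha0, h0]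
  · rw [pairing, pairing, adjointKernel, if_neg h0, inner_zero_left, inner_zero_left, zero_add,
      add_zero, inner_smul_right, real_inner_self_eq_norm_sq, ← alpha0_mul hβ hμ h0,
      real_inner_comm dphi (invD μ dphi)]

theorem exists_first_order_iff (hβ : 0 < β) (hμ : -1 < μ) (κ V₀ : ℝ) :
    (∃ U : opC.domain × (opD μ).domain, opL β μ U = (-(V₀ • dphi), -(κ • dphi))) ↔
      V₀ = -alpha0 β μ * κ := by
  rw [exists_opL_eq_iff_pairing (G := (_, _)) hβ hμ (hasWeakDeriv_dphi.smul V₀).neg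
    (hasWeakDeriv_dphi.smul κ).neg]
  have e : ((-(V₀ • dphi), -(κ • dphi)) : L2R × L2R)
      = (-V₀) • ((dphi, 0) : L2R × L2R) - κ • ((0, dphi) : L2R × L2R) := by
    ext1 <;> simp
  rw [e, pairing_sub, pairing_smul, pairing_smul, pairing_first_order hβ hμ]
  have h := pairing_dphi_ne_zero hβ hμ
  constructor
  · intro h1
    refine mul_right_cancel₀ h ?_
    linarith
  · rintro rfl
    ring

theorem exists_third_order_iff (hβ : 0 < β) (hμ : -1 < μ) (k V₂ : ℝ) :
    (∃ U : opC.domain × (opD μ).domain,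
      opL β μ U = k • wBar1 β μ - V₂ • ((dphi, 0) : L2R × L2R)) ↔ V₂ = nu β μ * k := by
  obtain ⟨q', hq⟩ := (qBar1_spec hβ hμ).1.hasWeakDeriv
  obtain ⟨p', hp⟩ := (pBar1_spec hβ hμ).1.hasWeakDeriv
  rw [exists_opL_eq_iff_pairing (G := (_, _)) hβ hμ
    ((((hp.smul (alpha0 β μ)).add hq).smul k).sub (hasWeakDeriv_dphi.smul V₂))
    (((hp.neg.add (hq.smul (alpha0 β μ))).smul k).sub (HasWeakDeriv.zero.smul V₂)),
    pairing_sub, pairing_smul, pairing_smul, nu]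
  have h := pairing_dphi_ne_zero hβ hμ
  field_simp
  rw [sub_eq_zero, eq_comm]

theorem exists_unique_first_correction (hβ : 0 < β) (hμ : -1 < μ) :
    ∃ U : opC.domain × (opD μ).domain,
      ((U.1 : L2R), (U.2 : L2R)) = (pBar1 β μ, qBar1 β μ) ∧
      inner ℝ (U.1 : L2R) dphi = 0 ∧ opL β μ U = (alpha0 β μ • dphi, -dphi) ∧
      ∀ U' : opC.domain × (opD μ).domain,
        inner ℝ (U'.1 : L2R) dphi = 0 → opL β μ U' = (alpha0 β μ • dphi, -dphi) → U' = U := by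
  obtain ⟨hq, hqi⟩ := qBar1_spec hβ hμ
  obtain ⟨hp, hpo⟩ := pBar1_spec hβ hμ
  obtain ⟨U, hU, hUL⟩ := (exists_opL_iff (F := (alpha0 β μ • dphi, -dphi))).mpr
    ⟨hq, by rwa [neg_neg]⟩
  obtain ⟨hU1, hU2⟩ := Prod.mk.inj hU
  refine ⟨U, hU, by rw [hU1, hpo], hUL, fun U' hU'o hU'L => ?_⟩
  obtain ⟨hq', hp'⟩ := exists_opL_iff.mp ⟨U', rfl, hU'L⟩
  rw [neg_neg] at hp'
  have eq : (U'.2 : L2R) = qBar1 β μ := by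
    by_cases h0 : μ = 0
    · subst h0
      have h1 := hq'.sub hq
      rw [sub_self] at h1
      obtain ⟨c, hc⟩ := h1.ladder_of_zero.exists_eq_smul_psi
      have h2 := hp'.inner_dphi_eq_zero
      rw [inner_sub_left, inner_smul_left, real_inner_self_eq_norm_sq, ← hqi] at h2
      simp only [conj_trivial] at h2
      rw [← mul_sub, ← inner_sub_left] at h2
      have h3 : inner ℝ ((U'.2 : L2R) - qBar1 β 0) dphi = 0 := by
        rw [← neg_sub, inner_neg_left, (mul_eq_zero.mp h2).resolve_left hβ.ne', neg_zero]
      rw [hc, inner_smul_left] at h3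
      have h4 : c = 0 := (mul_eq_zero.mp h3).resolve_right inner_psi_dphi_pos.ne'
      rw [h4, zero_smul] at hc
      exact sub_eq_zero.mp hc
    · exact hq'.unique_one hμ h0 hq
  rw [eq] at hp'
  exact Prod.ext (Subtype.ext ((hp'.unique_two hp hU'o hpo).trans hU1.symm))
    (Subtype.ext (eq.trans hU2.symm))

/-! ### The surface diffusion coefficient -/

/-- The formula for `ν` from which its sign and its limit are read off; it is uniform in `μ`. -/
theorem nu_eq (hβ : 0 < β) (hμ : -1 < μ) :
    nu β μ = (‖β • qBar1 β μ‖ ^ 2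
      - β * alpha0 β μ * inner ℝ (dphi - β • qBar1 β μ) (pBar1 β μ)
      + alpha0 β μ ^ 2 * ‖dphi‖ ^ 2) / (β * ‖dphi‖ ^ 2) := by
  have hN := norm_dphi_sq_pos.ne'
  have hN' := norm_ne_zero_iff.mpr dphi_ne_zero
  have hpo := (pBar1_spec hβ hμ).2
  by_cases h0 : μ = 0
  · have hJ := inner_psi_dphi_pos.ne'
    have ha : alpha0 β μ = 0 := by rw [alpha0, if_pos h0]
    simp only [nu, pairing, wBar1, adjointKernel, if_pos h0, ha, qBar1, inner_zero_right,
      zero_smul, zero_add, add_zero, inner_smul_left, norm_smul, mul_pow, real_inner_self_eq_norm_sq,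
      conj_trivial, real_inner_comm psi dphi, Real.norm_eq_abs, sq_abs]
    field_simp
    ring
  · have hm := inner_invD_ne_zero hμ h0
    have ha := alpha0_mul hβ hμ h0
    have ha0 : alpha0 β μ ≠ 0 := fun h => by
      rw [h, zero_mul] at ha
      exact hN ha.symm
    have hq : qBar1 β μ = alpha0 β μ • invD μ dphi := by rw [qBar1, if_neg h0]
    rw [real_inner_comm] at hpo
    simp only [nu, pairing, wBar1, adjointKernel, if_neg h0, hq, inner_zero_left, add_zero,
      inner_add_left, inner_sub_left, inner_neg_left, inner_smul_left, inner_smul_right, norm_smul,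
      mul_pow, real_inner_self_eq_norm_sq, conj_trivial, Real.norm_eq_abs, sq_abs,
      real_inner_comm (invD μ dphi) dphi, real_inner_comm dphi (pBar1 β μ), hpo,
      real_inner_comm (pBar1 β μ) (invD μ dphi)]
    rw [← ha]
    field_simp
    ring

/-- The bound `⟨C p̄₁, p̄₁⟩ ≤ ‖φ' - β q̄₁‖² / 3` comes from the lower bound `3` of `-∂² - 2ψ² + 4`,
the operator obtained from `C` by exchanging its factors. -/
theorem inner_pBar1_bounds (hβ : 0 < β) (hμ : -1 < μ) :
    0 ≤ inner ℝ (dphi - β • qBar1 β μ) (pBar1 β μ) ∧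
      3 * inner ℝ (dphi - β • qBar1 β μ) (pBar1 β μ) ≤ ‖β • qBar1 β μ‖ ^ 2 - ‖dphi‖ ^ 2 := by
  obtain ⟨hq, hqi⟩ := qBar1_spec hβ hμ
  obtain ⟨q', hd⟩ := hq.hasWeakDeriv
  obtain ⟨v, -, h2, h3⟩ := (pBar1_spec hβ hμ).1.exists_inner_eq
  rw [zero_smul, zero_sub] at h2
  have h4 := PoschlTeller.mul_norm_sq_le_of_ladder_neg norm_sq_le_of_poschlTeller_neg_two h2
    ((hasWeakDeriv_dphi.sub (hd.smul β)).neg.ladder 2)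
  rw [norm_neg, norm_sub_sq_real, real_inner_comm, inner_smul_left] at h4
  simp only [conj_trivial] at h4
  rw [hqi] at h4
  rw [h3, zero_mul, add_zero]
  exact ⟨sq_nonneg _, by linarith⟩

/-- The sign of `ν` is that of `‖s‖² - β α₀ ⟨C p̄₁, p̄₁⟩` up to a nonnegative term, with `s = β q̄₁`;
here `⟨C p̄₁, p̄₁⟩ ≤ ‖s‖² / 3` and `β |α₀| ≤ 4 |μ| / 3`. -/
theorem nu_pos (hβ : 0 < β) (hμ : |μ| < 1) : 0 < nu β μ := by
  have hμ' : -1 < μ := (abs_lt.mp hμ).1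
  obtain ⟨h1, h2⟩ := inner_pBar1_bounds hβ hμ'
  have h3 := abs_mul_alpha0_le hβ hμ'
  have h4 := norm_dphi_sq_pos
  have h5 := le_abs_self (β * alpha0 β μ)
  rw [nu_eq hβ hμ']
  refine div_pos ?_ (mul_pos hβ h4)
  have h6 : 0 ≤ alpha0 β μ ^ 2 * ‖dphi‖ ^ 2 := by positivity
  have h7 : β * alpha0 β μ * inner ℝ (dphi - β • qBar1 β μ) (pBar1 β μ)
      ≤ 4 / 3 * inner ℝ (dphi - β • qBar1 β μ) (pBar1 β μ) :=
    mul_le_mul_of_nonneg_right (by linarith) h1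
  linarith

/-- The component of `s = β q̄₁` orthogonal to `ψ` is `O(μ)`: `D` is bounded below by `1 + μ`
there. -/
theorem exists_qBar1_decomposition (hβ : 0 < β) (hμ : |μ| < 1 / 2) :
    ∃ (c : ℝ) (t : L2R), β • qBar1 β μ = c • psi + t ∧ inner ℝ psi t = 0 ∧
      ‖t‖ ≤ 8 / 3 * ‖dphi‖ * |μ| := by
  have hμ' : -1 / 2 < μ := by linarith [(abs_lt.mp hμ).1]
  have hP : inner ℝ psi psi ≠ 0 := inner_self_ne_zero.mpr psi_ne_zero
  set s := β • qBar1 β μ with hs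
  set a := β * alpha0 β μ with ha
  have hsD : PoschlTeller 1 μ s (a • dphi) := by
    have := (qBar1_spec hβ (μ := μ) (by linarith)).1.smul β
    rwa [smul_smul] at this
  set c := inner ℝ psi s / inner ℝ psi psi with hc
  set t := s - c • psi with ht
  have hto : inner ℝ psi t = 0 := by
    rw [ht, inner_sub_right, real_inner_smul_right psi psi c, hc, div_mul_cancel₀ _ hP, sub_self]
  refine ⟨c, t, by rw [ht]; abel, hto, ?_⟩
  have htD := hsD.sub ((poschlTeller_of_ladder (k := μ) ladder_psi).smul c)
  rw [← ht] at htD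
  obtain ⟨v, h1, -, h2⟩ := htD.exists_inner_eq
  have h3 := PoschlTeller.mul_norm_sq_le_of_orthogonal one_pos
    (exists_poschlTeller_neg_one (by norm_num)) norm_sq_le_of_poschlTeller_neg_one h1 fun z hz => by
      obtain ⟨d, rfl⟩ := hz.exists_eq_smul_psi
      rw [inner_smul_left, hto, mul_zero]
  rw [inner_sub_left, inner_smul_left, inner_smul_left, inner_smul_left, hto] at h2
  simp only [conj_trivial, mul_zero, sub_zero] at h2
  have h4 : a * inner ℝ dphi t ≤ |a| * (‖dphi‖ * ‖t‖) :=
    (le_abs_self _).trans (by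
      rw [abs_mul]
      exact mul_le_mul_of_nonneg_left (abs_real_inner_le_norm _ _) (abs_nonneg _))
  have h5 : |a| ≤ 4 / 3 * |μ| := abs_mul_alpha0_le hβ (by linarith)
  have h6 : |a| * (‖dphi‖ * ‖t‖) ≤ 4 / 3 * |μ| * (‖dphi‖ * ‖t‖) :=
    mul_le_mul_of_nonneg_right h5 (by positivity)
  by_cases h0 : ‖t‖ = 0
  · rw [h0]
    positivity
  have h7 : 0 < ‖t‖ := lt_of_le_of_ne (norm_nonneg _) (Ne.symm h0)
  refine le_of_mul_le_mul_right ?_ h7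
  nlinarith [sq_nonneg ‖t‖]

end Coefficients

/-- The expansion of `ν` at `μ = 0`, from `s = β q̄₁ = c ψ + t` with `t = O(μ)`, where the
normalization `⟨s, φ'⟩ = ‖φ'‖²` determines `c` up to `O(μ)`. -/
theorem nu_sub_isBigO {β : ℝ} (hβ : 0 < β) :
    (fun μ : ℝ => nu β μ - ‖dphi‖ ^ 2 * ‖psi‖ ^ 2 / (β * inner ℝ psi dphi ^ 2))
      =O[𝓝 0] (fun μ : ℝ => μ) := by
  have hex : ∀ μ : ℝ, ∃ ct : ℝ × L2R, |μ| < 1 / 2 → β • qBar1 β μ = ct.1 • psi + ct.2 ∧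
      inner ℝ psi ct.2 = 0 ∧ ‖ct.2‖ ≤ 8 / 3 * ‖dphi‖ * |μ| := by
    intro μ
    by_cases hμ : |μ| < 1 / 2
    · obtain ⟨c, t, h⟩ := exists_qBar1_decomposition hβ hμ
      exact ⟨(c, t), fun _ => h⟩
    · exact ⟨0, fun h => (hμ h).elim⟩
  choose ct hct using hex
  set J := inner ℝ psi dphi with hJ
  have hJ0 : J ≠ 0 := inner_psi_dphi_pos.ne'
  have hN := norm_dphi_sq_pos.ne'
  set c₀ := ‖dphi‖ ^ 2 / J with hc₀
  set E : ℝ → ℝ := fun μ => inner ℝ (dphi - β • qBar1 β μ) (pBar1 β μ) with hE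
  have hev : ∀ᶠ μ : ℝ in 𝓝 0, |μ| < 1 / 2 := by
    have : Tendsto (fun μ : ℝ => |μ|) (𝓝 0) (𝓝 |0|) := continuous_abs.continuousAt
    rw [abs_zero] at this
    exact this.eventually_lt_const (by norm_num)
  have hid : (fun μ : ℝ => μ) =O[𝓝 0] (fun _ => (1 : ℝ)) :=
    (continuous_id.continuousAt (x := (0 : ℝ))).isBigO_one ℝ
  have ht : (fun μ => ‖(ct μ).2‖) =O[𝓝 0] (fun μ : ℝ => μ) := by
    refine Asymptotics.IsBigO.of_bound (8 / 3 * ‖dphi‖) ?_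
    filter_upwards [hev] with μ hμ
    rw [norm_norm]
    exact (hct μ hμ).2.2
  have ha : (fun μ => β * alpha0 β μ) =O[𝓝 0] (fun μ : ℝ => μ) := by
    refine Asymptotics.IsBigO.of_bound (4 / 3) ?_
    filter_upwards [hev] with μ hμ
    exact abs_mul_alpha0_le hβ (by linarith [(abs_lt.mp hμ).1])
  have ha' : (fun μ => alpha0 β μ) =O[𝓝 0] (fun μ : ℝ => μ) := by
    refine (ha.const_mul_left β⁻¹).congr_left fun μ => ?_
    rw [inv_mul_cancel_left₀ hβ.ne']
  have hc : (fun μ => (ct μ).1 - c₀) =O[𝓝 0] (fun μ : ℝ => μ) := by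
    refine Asymptotics.IsBigO.trans (Asymptotics.IsBigO.of_bound (|J|⁻¹ * ‖dphi‖) ?_) ht
    filter_upwards [hev] with μ hμ
    obtain ⟨h1, h2, -⟩ := hct μ hμ
    have h3 := (qBar1_spec hβ (μ := μ) (by linarith [(abs_lt.mp hμ).1])).2
    have h4 : inner ℝ (β • qBar1 β μ) dphi = ‖dphi‖ ^ 2 := by
      rw [real_inner_smul_left, h3]
    rw [h1, inner_add_left, real_inner_smul_left, ← hJ] at h4
    have h5 : (ct μ).1 - c₀ = -(J⁻¹ * inner ℝ (ct μ).2 dphi) := by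
      rw [hc₀]
      field_simp
      linarith
    rw [h5, norm_neg, norm_mul, norm_inv, Real.norm_eq_abs, Real.norm_eq_abs, norm_norm, mul_assoc,
      mul_comm ‖dphi‖]
    exact mul_le_mul_of_nonneg_left (abs_real_inner_le_norm _ _) (by positivity)
  have ht2 : (fun μ => ‖(ct μ).2‖ ^ 2) =O[𝓝 0] (fun μ : ℝ => μ) := by
    simpa [sq] using ht.mul (ht.trans hid)
  have hc2 : (fun μ => (ct μ).1 ^ 2 - c₀ ^ 2) =O[𝓝 0] (fun μ : ℝ => μ) := by
    have h1 : (fun μ => ((ct μ).1 - c₀) * ((ct μ).1 - c₀)) =O[𝓝 0] (fun μ : ℝ => μ) := by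
      simpa using hc.mul (hc.trans hid)
    refine (h1.add (hc.const_mul_left (2 * c₀))).congr_left fun μ => ?_
    ring
  have hs : (fun μ => (‖β • qBar1 β μ‖ ^ 2 - c₀ ^ 2 * ‖psi‖ ^ 2 : ℝ))
      =O[𝓝 0] (fun μ : ℝ => μ) := by
    refine ((hc2.const_mul_left (‖psi‖ ^ 2)).add ht2).congr' ?_ EventuallyEq.rfl
    filter_upwards [hev] with μ hμ
    obtain ⟨h1, h2, -⟩ := hct μ hμ
    rw [h1, norm_add_sq_real, real_inner_smul_left, h2, norm_smul, mul_pow, Real.norm_eq_abs,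
      sq_abs]
    ring
  have hs1 : (fun μ => (‖β • qBar1 β μ‖ ^ 2 : ℝ)) =O[𝓝 0] (fun _ => (1 : ℝ)) := by
    refine ((hs.trans hid).add (Asymptotics.isBigO_const_const (c₀ ^ 2 * ‖psi‖ ^ 2)
      one_ne_zero _)).congr_left fun μ => ?_
    ring
  have hE1 : E =O[𝓝 0] (fun _ => (1 : ℝ)) := by
    refine Asymptotics.IsBigO.trans (Asymptotics.IsBigO.of_bound 1 ?_) hs1
    filter_upwards [hev] with μ hμ
    obtain ⟨h1, h2⟩ := inner_pBar1_bounds hβ (μ := μ) (by linarith [(abs_lt.mp hμ).1])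
    rw [Real.norm_of_nonneg h1, Real.norm_of_nonneg (by positivity)]
    linarith [norm_dphi_sq_pos]
  have haE : (fun μ => β * alpha0 β μ * E μ) =O[𝓝 0] (fun μ : ℝ => μ) := by
    simpa using ha.mul hE1
  have haa : (fun μ => alpha0 β μ * alpha0 β μ) =O[𝓝 0] (fun μ : ℝ => μ) := by
    simpa using ha'.mul (ha'.trans hid)
  refine (((hs.sub haE).add (haa.const_mul_left (‖dphi‖ ^ 2))).const_mul_left
    (β * ‖dphi‖ ^ 2)⁻¹).congr' ?_ EventuallyEq.rfl
  filter_upwards [hev] with μ hμ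
  have hN' := norm_ne_zero_iff.mpr dphi_ne_zero
  rw [nu_eq hβ (by linarith [(abs_lt.mp hμ).1]), hc₀]
  field_simp
  ring

/-! ### Growth rates -/

theorem bddAbove_range_growthRate {β μ ε : ℝ} (hε : 0 < ε) (hν : 0 < nu β μ) :
    BddAbove (Set.range (growthRate β μ ε)) := by
  have hB : 0 < ε ^ 2 * nu β μ := by positivity
  refine ⟨alpha0 β μ ^ 2 / (4 * (ε ^ 2 * nu β μ)), ?_⟩
  rintro _ ⟨k, rfl⟩
  rw [growthRate, le_div_iff₀ (by positivity)]
  nlinarith [sq_nonneg (alpha0 β μ + 2 * (ε ^ 2 * nu β μ) * k ^ 2)]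

theorem tendsto_growthRate_atBot {β μ ε : ℝ} (hε : 0 < ε) (hν : 0 < nu β μ) :
    Tendsto (growthRate β μ ε) atTop atBot := by
  have hB : 0 < ε ^ 2 * nu β μ := by positivity
  have h2 : Tendsto (fun k : ℝ => k ^ 2) atTop atTop := tendsto_pow_atTop two_ne_zero
  have h3 : Tendsto (fun k : ℝ => -alpha0 β μ + -(ε ^ 2 * nu β μ) * k ^ 2) atTop atBot :=
    tendsto_atBot_add_const_left _ _ (h2.const_mul_atTop_of_neg (neg_neg_of_pos hB))
  refine (h2.atTop_mul_atBot₀ h3).congr fun k => ?_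
  rw [growthRate]
  ring

theorem tendsto_growthRate_zero_atTop {β μ : ℝ} (hα : alpha0 β μ < 0) :
    Tendsto (growthRate β μ 0) atTop atTop := by
  have h2 : Tendsto (fun k : ℝ => k ^ 2) atTop atTop := tendsto_pow_atTop two_ne_zero
  refine (h2.const_mul_atTop (neg_pos.mpr hα)).congr fun k => ?_
  rw [growthRate]
  ring

theorem mainTheorem3 :
    -- the objects in the definition of the coefficients exist and are unique, and `α₀` and `ν` are
    -- the coefficients which the solvability conditions select
    (∀ β μ : ℝ, 0 < β → -1 < μ →
      (μ ≠ 0 →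
        (∃ r : (opD μ).domain, (r : L2R) = invD μ dphi ∧ opD μ r = dphi ∧
          ∀ r' : (opD μ).domain, opD μ r' = dphi → r' = r) ∧
        inner ℝ (invD μ dphi) dphi ≠ 0) ∧
      (∃ U : opC.domain × (opD μ).domain,
        ((U.1 : L2R), (U.2 : L2R)) = (pBar1 β μ, qBar1 β μ) ∧
        inner ℝ (U.1 : L2R) dphi = 0 ∧ opL β μ U = (alpha0 β μ • dphi, -dphi) ∧
        ∀ U' : opC.domain × (opD μ).domain,
          inner ℝ (U'.1 : L2R) dphi = 0 → opL β μ U' = (alpha0 β μ • dphi, -dphi) → U' = U) ∧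
      (∀ κ V₀ : ℝ,
        (∃ U : opC.domain × (opD μ).domain, opL β μ U = (-(V₀ • dphi), -(κ • dphi))) ↔
          V₀ = -alpha0 β μ * κ) ∧
      pairing (dphi, 0) (adjointKernel β μ) ≠ 0 ∧
      (∀ k V₂ : ℝ,
        (∃ U : opC.domain × (opD μ).domain,
          opL β μ U = k • wBar1 β μ - V₂ • ((dphi, 0) : L2R × L2R)) ↔ V₂ = nu β μ * k) ∧
      -- `α₀` has the sign of `μ`
      SignType.sign (alpha0 β μ) = SignType.sign μ) ∧
    -- the expansion of `ν`
    (∀ β : ℝ, 0 < β →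
      (fun μ : ℝ => nu β μ - ‖dphi‖ ^ 2 * ‖psi‖ ^ 2 / (β * inner ℝ psi dphi ^ 2))
        =O[𝓝 0] (fun μ : ℝ => μ)) ∧
    -- positivity of `ν`, and regularization of the motion against curvature
    (∃ μs ∈ Set.Ioo (0 : ℝ) 1, ∀ β μ : ℝ, 0 < β → |μ| < μs →
      0 < nu β μ ∧
      ∀ ε : ℝ, 0 < ε →
        BddAbove (Set.range (growthRate β μ ε)) ∧
        Tendsto (growthRate β μ ε) atTop atBot ∧
        (μ < 0 → Tendsto (growthRate β μ 0) atTop atTop)) := by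
  refine ⟨fun β μ hβ hμ => ⟨fun h0 => ⟨?_, inner_invD_ne_zero hμ h0⟩,
    exists_unique_first_correction hβ hμ, exists_first_order_iff hβ hμ,
    pairing_dphi_ne_zero hβ hμ, exists_third_order_iff hβ hμ, sign_alpha0 hβ hμ⟩,
    fun β hβ => nu_sub_isBigO hβ, 1 / 2, by norm_num, fun β μ hβ hμ => ?_⟩
  · obtain ⟨r, hr, hrD⟩ := (opD_iff μ _ _).mpr (invD_spec hμ h0)
    refine ⟨r, hr, hrD, fun r' hr' => Subtype.ext ?_⟩
    have h1 := opD_spec r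
    have h2 := opD_spec r'
    rw [hrD] at h1
    rw [hr'] at h2
    exact h2.unique_one hμ h0 h1
  · have hν : 0 < nu β μ := nu_pos hβ (by linarith)
    have hμ' : -1 < μ := by linarith [(abs_lt.mp hμ).1]
    refine ⟨hν, fun ε hε => ⟨bddAbove_range_growthRate hε hν, tendsto_growthRate_atBot hε hν,
      fun h => tendsto_growthRate_zero_atTop ?_⟩⟩
    rw [← sign_eq_neg_one_iff, sign_alpha0 hβ hμ', sign_neg h]
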